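/- Let $p,q\ge 1$, let $a_1,\dots,a_p,b_1,\dots,b_q$ be real, let $A_1,\dots,A_p,B_1,\dots,B_q>0$, and put $$\rho=\prod_{i=1}^pA_i^{A_i}\prod_{j=1}^qB_j^{-B_j},\qquad \mu=\sum_{j=1}^q b_j-\sum_{i=1}^p a_i+\frac{p-q}{2},\qquad \gamma=\min_{1\le i\le p}\frac{a_i}{A_i}.$$ The Fox--Wright function is $${}_p\Psi_q\Big[{(a_p,A_p)\atop (b_q,B_q)}\Big|z\Big]=\sum_{k\ge0}\frac{\prod_{l=1}^p\Gamma(a_l+kA_l)}{\prod_{l=1}^q\Gamma(b_l+kB_l)}\frac{z^k}{k!}$$ (with $1/\Gamma=0$ at the poles of $\Gamma$), the generalized binomial coefficient is $\binom{x}{y}=\frac{\Gamma(x+1)}{\Gamma(y+1)\Gamma(x-y+1)}$, the finite Laplace transform is $\mathcal L_Tf(t)=\int_0^Te^{-\xi t}f(\xi)\,d\xi$, and Fox's $H$-function is $$H(\xi)=H^{p,0}_{q,p}\Big(\xi\Big|{(B_q,b_q)\atop (A_p,a_p)}\Big)=\frac1{2\pi i}\int_{c-i\infty}^{c+i\infty}\frac{\prod_{j=1}^p\Gamma(A_js+a_j)}{\prod_{k=1}^q\Gamma(B_ks+b_k)}\,\xi^{-s}\,ds,$$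 the integral being the limit of the integrals from $c-iR$ to $c+iR$ as $R\to\infty$, where $c>-\gamma$ is arbitrary (all poles lie to the left of the line). Suppose that $\sum_iA_i=\sum_jB_j$, $\mu>0$, $\gamma>0$ and $\lambda>0$. Then the limit defining $H(\xi)$ exists for every $\xi\in(0,\rho)$. For all real $z$ and all real $t$ with $\rho|t|<1$ (in particular for all $|t|<1$ if $\rho\le1$), every Fox--Wright series below converges, the function $\xi\mapsto e^{z\xi}\xi^{-1}(1-t\xi)^{-\lambda}H(\xi)$ is integrable on $(0,\rho)$, and $$\sum_{k=0}^\infty\binom{\lambda+k-1}{k}\,{}_p\Psi_q\Big[{(a_p+kA_p,A_p)\atop(b_q+kB_q,B_q)}\Big|z\Big]t^k=\mathcal L_\rho\Big(\xi^{-1}(1-t\xi)^{-\lambda}H(\xi)\Big)(-z),$$ the series on the left converging absolutely. If moreover $\gamma\ge1$ and $H\ge0$ on $(0,\rho)$, then for all $z>0$ and all real $t$ with $\rho|t|<1$ the Fox--Wright series of ${}_{p+1}\Psi_q$ at $t$ converges and $$\frac1{\Gamma(\lambda)}\,{}_{p+1}\Psi_q\Big[{(\lambda,1),(a_p,A_p)\atop(b_q,B_q)}\Big|t\Big]\le\sum_{k=0}^\infty\binom{\lambda+k-1}{k}\,{}_p\Psi_q\Big[{(a_p+kA_p,A_p)\atop(b_q+kB_q,B_q)}\Big|z\Big]t^k\le\frac{e^{\rho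 z}}{\Gamma(\lambda)}\,{}_{p+1}\Psi_q\Big[{(\lambda,1),(a_p,A_p)\atop(b_q,B_q)}\Big|t\Big].$$ -/

import Mathlib

open Filter Topology MeasureTheory

noncomputable section

/-- The generalized binomial coefficient `Γ(x+1) / (Γ(y+1) Γ(x-y+1))`. -/
def genBinom (x y : ℝ) : ℝ :=
  Real.Gamma (x + 1) / (Real.Gamma (y + 1) * Real.Gamma (x - y + 1))

/-- The `k`-th term of the Fox-Wright series with numerator parameters `(a_l, A_l)` and
denominator parameters `(b_l, B_l)`. (In Mathlib `Γ` takes the value `0` at its poles and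
`x / 0 = 0`, so a pole in the denominator gives the term `0`, as with the entire function `1/Γ`.) -/
def foxWrightTerm {p q : ℕ} (a A : Fin p → ℝ) (b B : Fin q → ℝ) (z : ℝ) (k : ℕ) : ℝ :=
  (∏ l, Real.Gamma (a l + k * A l)) / (∏ l, Real.Gamma (b l + k * B l)) *
    (z ^ k / (k.factorial : ℝ))

/-- The Fox-Wright function `pΨq[(a,A);(b,B) | z]`. -/
def foxWright {p q : ℕ} (a A : Fin p → ℝ) (b B : Fin q → ℝ) (z : ℝ) : ℝ :=
  ∑' k : ℕ, foxWrightTerm a A b B z k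

/-- The endpoint `ρ = ∏ A_i ^ A_i * ∏ B_j ^ (-B_j)`. -/
def foxRho {p q : ℕ} (A : Fin p → ℝ) (B : Fin q → ℝ) : ℝ :=
  (∏ i, A i ^ A i) * ∏ j, B j ^ (-B j)

/-- `μ = ∑ b_j - ∑ a_k + (p - q) / 2`. -/
def foxMu {p q : ℕ} (a : Fin p → ℝ) (b : Fin q → ℝ) : ℝ :=
  ∑ j, b j - ∑ k, a k + ((p : ℝ) - (q : ℝ)) / 2

/-- `γ = min_j a_j / A_j`; the rightmost pole of the kernel below is `-γ`. -/
def foxGamma {p : ℕ} (a A : Fin p → ℝ) : ℝ :=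
  ⨅ j, a j / A j

/-- The Mellin-Barnes kernel `∏ Γ(A_j s + a_j) / ∏ Γ(B_k s + b_k)`. -/
def foxKernel {p q : ℕ} (a A : Fin p → ℝ) (b B : Fin q → ℝ) (s : ℂ) : ℂ :=
  (∏ j, Complex.Gamma ((A j : ℂ) * s + (a j : ℂ))) /
    ∏ k, Complex.Gamma ((B k : ℂ) * s + (b k : ℂ))

/-- `(1 / 2πi) ∫ kernel(s) z^(-s) ds` over the segment from `c - iR` to `c + iR`. -/
def foxHTruncated {p q : ℕ} (a A : Fin p → ℝ) (b B : Fin q → ℝ) (c : ℝ) (z : ℂ) (R : ℝ) : ℂ :=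
  (2 * (Real.pi : ℂ) * Complex.I)⁻¹ *
    ∫ y in (-R)..R, foxKernel a A b B ((c : ℂ) + (y : ℂ) * Complex.I) *
      z ^ (-((c : ℂ) + (y : ℂ) * Complex.I)) * Complex.I

/-- Fox's function `H^{p,0}_{q,p}(z | (B,b); (A,a))`: the Mellin-Barnes integral along the vertical
line `Re s = c`, traversed upward, as the limit of the integrals from `c - iR` to `c + iR`. The line
has to leave all poles of the kernel on its left, that is, `c > -γ`. -/
def foxH {p q : ℕ} (a A : Fin p → ℝ) (b B : Fin q → ℝ) (c : ℝ) (z : ℂ) : ℂ :=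
  limUnder atTop (foxHTruncated a A b B c z)

/-- The finite Laplace transform `∫_0^T e^(-ξ t) f(ξ) dξ`. -/
def finiteLaplace (T : ℝ) (f : ℝ → ℂ) (t : ℝ) : ℂ :=
  ∫ ξ in (0 : ℝ)..T, (Real.exp (-ξ * t) : ℂ) * f ξ

/-- The function `ξ ↦ ξ⁻¹ (1 - t ξ)^(-λ) H^{p,0}_{q,p}(ξ)`. -/
def foxIntegrand {p q : ℕ} (a A : Fin p → ℝ) (b B : Fin q → ℝ) (c lam t : ℝ) (ξ : ℝ) : ℂ :=
  ((ξ⁻¹ * (1 - t * ξ) ^ (-lam) : ℝ) : ℂ) * foxH a A b B c (ξ : ℂ)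

/-- The `k`-th term `binom(λ+k-1, k) pΨq[(a+kA, A); (b+kB, B) | z] t^k` of the generating
function. -/
def genTerm {p q : ℕ} (a A : Fin p → ℝ) (b B : Fin q → ℝ) (lam z t : ℝ) (k : ℕ) : ℝ :=
  genBinom (lam + k - 1) k *
    foxWright (fun l => a l + k * A l) A (fun l => b l + k * B l) B z * t ^ k

end

/-!
The function `H` is an inverse Mellin transform of the kernel
`K(s) = ∏ Γ(A_j s + a_j) / ∏ Γ(B_k s + b_k)`, so that `∫_0^ρ ξ^(n - 1) H(ξ) dξ = K(n)`. The term of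
index `n` of the `k`-th Fox-Wright series is `K(k + n) z^n / n!`; summing over `n` and `k` under the
integral sign gives `∫_0^ρ ξ⁻¹ (1 - t ξ)^(-λ) exp(z ξ) H(ξ) dξ`. At `z = 0` the same integral is
`(1 / Γ(λ))` times the Fox-Wright function with the additional parameter `(λ, 1)`, and the two-sided
inequality follows from `1 ≤ exp(z ξ) ≤ exp(ρ z)`.

The analytic content is the moment formula `foxH_moments`. For `0 < μ ≤ 1` the Mellin-Barnes integral
converges only conditionally, so its principal part is split off. Stirling's formula with error
`O(1 / s)` in the right half-plane (`isBigO_stirlingRecip`), together with `∑ A = ∑ B`, gives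
`ρ^(-s) K(s) = C (s + d)^(-μ) + R(s)` with `R(s) = O(|s + d|^(-μ - 1))` on every half-plane to the
right of the poles (`exists_foxKernel_sub_le`). In the variable `x = log (ρ / ξ)` the integral of the
power is the Gamma density `x^(μ - 1) exp(-d x) / Γ(μ)` (`tendsto_integral_exp_mul_cpow`, one
integration by parts). The integral of `R` converges absolutely; moving the line to the right shows
that it vanishes for `x < 0`, a line `Re s = c₀ < 0` shows that it decays as `x → ∞`, and Fourier
inversion recovers `R` as its Laplace transform (`HasHalfPlaneDecay.laplace_vertInv`). Since `γ > 0`,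
the line may be moved to the left of `Re s = 0`, and hence the moment formula holds for all `n ≥ 0`.
-/

/-! ### Stirling's formula in the right half-plane -/

/-- The first-order terms in `v = 1 / w` cancel, which makes the steps of the telescoping product
for `Γ` summable. -/
theorem isBigO_stirlingStep_nhdsNE (a : ℂ) :
    (fun v : ℂ => (1 + a * v) * Complex.exp (1 - (v⁻¹ + a + 1 / 2) * Complex.log (1 + v)) - 1)
      =O[𝓝[≠] 0] fun v => v ^ 2 := by
  set θ : ℂ → ℂ := fun v => Complex.log (1 + v) - (v - v ^ 2 / 2) with hθ
  set E : ℂ → ℂ := fun v => 1 - (v⁻¹ + a + 1 / 2) * Complex.log (1 + v) with hE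
  have hθO : θ =O[𝓝[≠] 0] fun v => v ^ 3 := by
    refine ((Complex.log_sub_logTaylor_isBigO 2).mono nhdsWithin_le_nhds).congr_left fun v => ?_
    simp [hθ, Complex.logTaylor, Finset.sum_range_succ]
    ring
  have hne : ∀ᶠ v : ℂ in 𝓝[≠] 0, v ≠ 0 := self_mem_nhdsWithin
  have hid : Tendsto (fun v : ℂ => v) (𝓝[≠] 0) (𝓝 0) := tendsto_id'.2 nhdsWithin_le_nhds
  have hpow : ∀ {m n : ℕ}, n ≤ m → (fun v : ℂ => v ^ m) =O[𝓝[≠] 0] fun v => v ^ n := by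
    intro m n h
    refine Asymptotics.IsBigO.of_bound 1 ?_
    filter_upwards [hid.eventually (Metric.ball_mem_nhds 0 one_pos)] with v hv
    have : ‖v‖ < 1 := by simpa using hv
    rw [norm_pow, norm_pow, one_mul]
    exact pow_le_pow_of_le_one (norm_nonneg _) this.le h
  have hvθ : (fun v => v⁻¹ * θ v) =O[𝓝[≠] 0] fun v => v ^ 2 := by
    refine ((Asymptotics.isBigO_refl (fun v : ℂ => v⁻¹) _).mul hθO).congr' (by rfl) ?_
    filter_upwards [hne] with v hv
    field_simp
  have hEa : (fun v => E v + a * v) =O[𝓝[≠] 0] fun v => v ^ 2 := by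
    have h1 : (fun v : ℂ => (a + 1 / 2) / 2 * v ^ 2) =O[𝓝[≠] 0] fun v : ℂ => v ^ 2 :=
      (Asymptotics.isBigO_refl _ _).const_mul_left _
    have h2 := (hθO.trans (hpow (by norm_num : 2 ≤ 3))).const_mul_left (a + 1 / 2)
    refine ((h1.sub hvθ).sub h2).congr' ?_ (by rfl)
    filter_upwards [hne] with v hv
    have : Complex.log (1 + v) = θ v + (v - v ^ 2 / 2) := by simp [hθ]
    simp only [hE, this]
    field_simp
    ring
  have hEv : E =O[𝓝[≠] 0] fun v => v := by
    have h1 : (fun v : ℂ => a * v) =O[𝓝[≠] 0] fun v : ℂ => v :=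
      (Asymptotics.isBigO_refl _ _).const_mul_left _
    refine ((hEa.trans ((hpow (by norm_num : 1 ≤ 2)).congr_right (by simp))).sub h1).congr_left ?_
    intro v; ring
  have hE0 : Tendsto E (𝓝[≠] 0) (𝓝 0) := hEv.trans_tendsto hid
  have hexp : (fun v => Complex.exp (E v) - 1 - E v) =O[𝓝[≠] 0] fun v => v ^ 2 := by
    have := (Complex.exp_sub_sum_range_isBigO_pow 2).comp_tendsto hE0
    refine (this.trans ?_).congr_left ?_
    · exact hEv.pow 2
    · intro v; simp [Finset.sum_range_succ, Function.comp]; ring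
  have hb : (fun v : ℂ => 1 + a * v) =O[𝓝[≠] 0] fun _ => (1 : ℂ) := by
    have : Tendsto (fun v : ℂ => 1 + a * v) (𝓝[≠] 0) (𝓝 (1 + a * 0)) :=
      tendsto_const_nhds.add (hid.const_mul a)
    exact this.isBigO_one ℂ
  have h3 : (fun v => a * v * E v) =O[𝓝[≠] 0] fun v => v ^ 2 := by
    have h1 : (fun v : ℂ => a * v) =O[𝓝[≠] 0] fun v : ℂ => v :=
      (Asymptotics.isBigO_refl _ _).const_mul_left _
    exact (h1.mul hEv).congr_right (fun v => by ring)
  refine (((hb.mul hexp).congr_right (g₂ := fun v : ℂ => v ^ 2) (by simp)).add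
    (hEa.add h3)).congr_left ?_
  intro v; simp only [hE]; ring

/-- The quotient of the values at `w` and `w + 1` of the normalised reciprocal Gamma function
`stirlingRecip a`. -/
noncomputable def stirlingStep (a w : ℂ) : ℂ :=
  (1 + a / w) * Complex.exp (1 - (w + a + 1 / 2) * Complex.log (1 + w⁻¹))

theorem isBigO_stirlingStep (a : ℂ) :
    (fun w => stirlingStep a w - 1) =O[Bornology.cobounded ℂ] fun w => (w ^ 2)⁻¹ := by
  have := (isBigO_stirlingStep_nhdsNE a).comp_tendsto
    (Filter.tendsto_inv₀_cobounded' (α := ℂ))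
  refine this.congr ?_ ?_
  · intro w; simp [stirlingStep, Function.comp, div_eq_mul_inv]
  · intro w; simp

/-- The reciprocal of `Γ(w + a)`, normalised by the main term of Stirling's formula. Working with
`1 / Γ` keeps the function entire in `a`, so that no pole has to be avoided. -/
noncomputable def stirlingRecip (a w : ℂ) : ℂ :=
  (Complex.Gamma (w + a))⁻¹ * Complex.exp ((w + a - 1 / 2) * Complex.log w - w)

theorem log_add_one_of_re_pos {w : ℂ} (hw : 0 < w.re) :
    Complex.log (w + 1) = Complex.log w + Complex.log (1 + w⁻¹) := by
  have h0 : w ≠ 0 := by rintro rfl; simp at hw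
  have h2 : 0 < (1 + w⁻¹).re := by
    rw [Complex.add_re, Complex.inv_re, Complex.one_re]
    have := Complex.normSq_pos.2 h0
    positivity
  have h3 : (1 + w⁻¹) ≠ 0 := by intro h; simp [h] at h2
  have e : w + 1 = w * (1 + w⁻¹) := by field_simp
  rw [e, Complex.log_mul h0 h3]
  have b1 := Complex.abs_arg_lt_pi_div_two_iff.2 (Or.inl hw)
  have b2 := Complex.abs_arg_lt_pi_div_two_iff.2 (Or.inl h2)
  rw [abs_lt] at b1 b2
  constructor <;> linarith [b1.1, b1.2, b2.1, b2.2]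

theorem stirlingRecip_eq_step_mul (a : ℂ) {w : ℂ} (hw : 0 < w.re) :
    stirlingRecip a w = stirlingStep a w * stirlingRecip a (w + 1) := by
  have h0 : w ≠ 0 := by rintro rfl; simp at hw
  rw [stirlingRecip, stirlingRecip, stirlingStep, log_add_one_of_re_pos hw,
    Complex.one_div_Gamma_eq_self_mul_one_div_Gamma_add_one (w + a),
    show w + 1 + a = w + a + 1 by ring]
  have h1 : (1 + a / w) = (w + a) * Complex.exp (-Complex.log w) := by
    rw [Complex.exp_neg, Complex.exp_log h0]; field_simp
  rw [h1]
  have : Complex.exp ((w + a - 1 / 2) * Complex.log w - w) =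
      Complex.exp (-Complex.log w) *
        Complex.exp (1 - (w + a + 1 / 2) * Complex.log (1 + w⁻¹)) *
        Complex.exp ((w + 1 + a - 1 / 2) * (Complex.log w + Complex.log (1 + w⁻¹)) - (w + 1)) := by
    rw [← Complex.exp_add, ← Complex.exp_add]
    congr 1; ring
  rw [this]; ring_nf

theorem stirlingRecip_eq_prod_mul (a : ℂ) {w : ℂ} (hw : 0 < w.re) (n : ℕ) :
    stirlingRecip a w =
      (∏ k ∈ Finset.range n, stirlingStep a (w + k)) * stirlingRecip a (w + n) := by
  induction n with
  | zero => simp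
  | succ n ih =>
    rw [ih, Finset.prod_range_succ, stirlingRecip_eq_step_mul a (w := w + n), mul_assoc]
    · push_cast; ring_nf
    · simp; positivity

theorem inv_Gamma_eq_prod_mul (s : ℂ) (n : ℕ) :
    (Complex.Gamma s)⁻¹ = (∏ j ∈ Finset.range n, (s + j)) * (Complex.Gamma (s + n))⁻¹ := by
  induction n with
  | zero => simp
  | succ n ih =>
    rw [ih, Finset.prod_range_succ, Complex.one_div_Gamma_eq_self_mul_one_div_Gamma_add_one (s + n)]
    push_cast; ring_nf

theorem tendsto_cpow_mul_factorial_mul_inv_Gamma {s : ℂ} (hs : ∀ m : ℕ, s ≠ -m) :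
    Tendsto (fun n : ℕ => (n : ℂ) ^ s * n.factorial * (Complex.Gamma (s + (n + 1)))⁻¹) atTop
      (𝓝 1) := by
  have hG := Complex.Gamma_ne_zero hs
  have h := (Complex.GammaSeq_tendsto_Gamma s).mul_const (Complex.Gamma s)⁻¹
  rw [mul_inv_cancel₀ hG] at h
  refine h.congr fun n => ?_
  have hp : ∏ j ∈ Finset.range (n + 1), (s + j) ≠ 0 := by
    refine Finset.prod_ne_zero_iff.2 fun j _ h => hs j (eq_neg_of_add_eq_zero_left h)
  rw [inv_Gamma_eq_prod_mul s (n + 1), Complex.GammaSeq]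
  push_cast
  field_simp

theorem exp_mul_log_sub_eq_factorial_div_stirlingSeq {n : ℕ} (hn : n ≠ 0) :
    Real.exp ((n + 1 / 2) * Real.log n - n) = n.factorial * (Stirling.stirlingSeq n)⁻¹ * (√2)⁻¹ := by
  have hn' : (0 : ℝ) < n := by positivity
  have hf : (n.factorial : ℝ) ≠ 0 := by positivity
  have h1 : Real.exp ((n + 1 / 2) * Real.log n - n) =
      (n : ℝ) ^ n * √n * (Real.exp 1 ^ n)⁻¹ := by
    rw [Real.exp_sub, add_mul, Real.exp_add, Real.sqrt_eq_rpow, Real.rpow_def_of_pos hn',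
      mul_comm (Real.log n) (1 / 2), ← Real.exp_nat_mul (1 : ℝ), mul_one, div_eq_mul_inv,
      Real.exp_nat_mul, Real.exp_log hn']
  have h2 : √(2 * n : ℝ) = √2 * √n := Real.sqrt_mul (by norm_num) _
  have h3 : √(2 : ℝ) ≠ 0 := by positivity
  rw [h1, Stirling.stirlingSeq, h2, div_pow]
  field_simp

/-- The limit along `w + 1, w + 2, …`, from Euler's product for `Γ` and Stirling's formula for `n!`.
-/
theorem tendsto_stirlingRecip_add_nat_add_one (a : ℂ) {w : ℂ} (hw : 0 < w.re)
    (hs : ∀ m : ℕ, w + a ≠ -m) :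
    Tendsto (fun n : ℕ => stirlingRecip a (w + (n + 1))) atTop
      (𝓝 ((√Real.pi : ℂ)⁻¹ * (√2 : ℂ)⁻¹)) := by
  set t : ℂ := w + 1 with ht
  have hlog : Tendsto (fun n : ℕ => (n : ℂ) * Complex.log (1 + t / n)) atTop (𝓝 t) := by
    refine Complex.tendsto_nat_mul_log_one_add_of_tendsto ?_
    refine tendsto_const_nhds.congr' ?_
    filter_upwards [eventually_ne_atTop 0] with n hn
    have : (n : ℂ) ≠ 0 := by exact_mod_cast hn
    field_simp
  have htn : Tendsto (fun n : ℕ => t / (n : ℂ)) atTop (𝓝 0) :=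
    tendsto_const_div_atTop_nhds_zero_nat t
  have hlog0 : Tendsto (fun n : ℕ => Complex.log (1 + t / n)) atTop (𝓝 0) := by
    have h1 : Tendsto (fun n : ℕ => 1 + t / (n : ℂ)) atTop (𝓝 1) := by
      simpa using htn.const_add 1
    simpa using h1.clog (by simp)
  have h3 : Tendsto (fun n : ℕ => Complex.exp ((w + a + n + 1 / 2) * Complex.log (1 + t / n) - t))
      atTop (𝓝 1) := by
    have := ((hlog0.const_mul (w + a + 1 / 2)).add hlog).sub_const t
    have h := (Complex.continuous_exp.tendsto _).comp this
    simp only [mul_zero, zero_add, sub_self, Complex.exp_zero] at h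
    refine h.congr fun n => ?_
    simp only [Function.comp]
    congr 1; ring
  have hst : Tendsto (fun n : ℕ => ((Stirling.stirlingSeq n : ℝ) : ℂ)⁻¹) atTop
      (𝓝 (√Real.pi : ℂ)⁻¹) := by
    refine Tendsto.inv₀ ?_ ?_
    · exact (Complex.continuous_ofReal.tendsto _).comp Stirling.tendsto_stirlingSeq_sqrt_pi
    · have : √Real.pi ≠ 0 := by positivity
      exact_mod_cast this
  have key := (((tendsto_cpow_mul_factorial_mul_inv_Gamma hs).mul hst).mul_const
    (√2 : ℂ)⁻¹).mul h3
  rw [one_mul, mul_one] at key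
  refine key.congr' ?_
  filter_upwards [eventually_ne_atTop 0] with n hn
  have hn' : (0 : ℝ) < n := by positivity
  have hnc : (n : ℂ) ≠ 0 := by exact_mod_cast hn
  have hpos : 0 < (1 + t / n).re := by
    have : (t / (n : ℂ)).re = t.re / n := by
      rw [← Complex.ofReal_natCast, Complex.div_ofReal_re]
    have ht' : t.re = w.re + 1 := by simp [ht]
    rw [Complex.add_re, this, ht', Complex.one_re]
    positivity
  have hlogn : Complex.log (w + (n + 1)) = (Real.log n : ℝ) + Complex.log (1 + t / n) := by
    rw [← Complex.log_ofReal_mul hn' (by intro h; simp [h] at hpos)]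
    congr 1
    push_cast
    field_simp
    rw [ht]; ring
  have hE := congrArg (fun x : ℝ => (x : ℂ)) (exp_mul_log_sub_eq_factorial_div_stirlingSeq hn)
  push_cast at hE
  rw [stirlingRecip, hlogn, Complex.cpow_def_of_ne_zero hnc]
  have : Complex.exp ((w + (n + 1) + a - 1 / 2) * ((Real.log n : ℝ) + Complex.log (1 + t / n))
      - (w + (n + 1))) = Complex.exp (Complex.log n * (w + a)) *
        Complex.exp ((n + 1 / 2) * Complex.log n - n) *
        Complex.exp ((w + a + n + 1 / 2) * Complex.log (1 + t / n) - t) := by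
    rw [← Complex.exp_add, ← Complex.exp_add, ht, Complex.ofReal_log hn'.le]
    push_cast
    congr 1; ring
  rw [this]
  rw [hE, show w + a + ((n : ℂ) + 1) = w + (n + 1) + a by ring]
  ring

theorem tendsto_stirlingRecip_add_nat (a : ℂ) {w : ℂ} (hw : 0 < w.re) :
    Tendsto (fun n : ℕ => stirlingRecip a (w + n)) atTop
      (𝓝 ((√Real.pi : ℂ)⁻¹ * (√2 : ℂ)⁻¹)) := by
  -- A shift by `m` moves `w + a` away from the poles of `Γ`.
  obtain ⟨m, hm⟩ := exists_nat_gt (-(w + a).re)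
  have h := tendsto_stirlingRecip_add_nat_add_one a (w := w + m) (by simp; positivity) (by
    intro k hk
    have := congrArg Complex.re hk
    simp at this hm
    have : (0 : ℝ) ≤ k := by positivity
    linarith)
  rw [← tendsto_add_atTop_iff_nat (m + 1)]
  refine h.congr fun n => ?_
  push_cast; ring_nf

theorem sum_range_inv_add_sq_le {r : ℝ} (hr : 1 ≤ r) (n : ℕ) :
    ∑ k ∈ Finset.range n, ((r + k) ^ 2)⁻¹ ≤ 2 / r := by
  have h : ∀ n : ℕ, ∑ k ∈ Finset.range n, ((r + k) ^ 2)⁻¹ ≤ 2 / r - 2 / (r + n) := by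
    intro n
    induction n with
    | zero => simp
    | succ n ih =>
      rw [Finset.sum_range_succ]
      have hp : 0 < r + n := by positivity
      have : ((r + n) ^ 2)⁻¹ ≤ 2 / (r + n) - 2 / (r + (n + 1 : ℕ)) := by
        push_cast
        rw [div_sub_div _ _ hp.ne' (by positivity), inv_eq_one_div,
          div_le_div_iff₀ (by positivity) (by positivity)]
        have : 1 ≤ r + n := by linarith [(Nat.cast_nonneg n : (0 : ℝ) ≤ n)]
        nlinarith
      linarith
  refine (h n).trans ?_
  have : 0 ≤ 2 / (r + n) := by positivity
  linarith

/-- Stirling's formula for `1 / Γ(w + a)` in the right half-plane, with relative error `O(1 / w)`.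
The normalised function telescopes along `w, w + 1, w + 2, …`, and each step is `1 + O(1 / w²)`. -/
theorem isBigO_stirlingRecip (a : ℂ) :
    (fun w => stirlingRecip a w - (√Real.pi : ℂ)⁻¹ * (√2 : ℂ)⁻¹)
      =O[Bornology.cobounded ℂ ⊓ 𝓟 {w | 0 < w.re}] fun w => w⁻¹ := by
  set L : ℂ := (√Real.pi : ℂ)⁻¹ * (√2 : ℂ)⁻¹
  obtain ⟨C, hC⟩ := (isBigO_stirlingStep a).bound
  obtain ⟨R, -, hR⟩ := (Filter.hasBasis_cobounded_norm (E := ℂ)).eventually_iff.1 hC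
  set C' := max C 0
  have hC' : ∀ w : ℂ, R ≤ ‖w‖ → ‖stirlingStep a w - 1‖ ≤ C' * (‖w‖ ^ 2)⁻¹ := fun w hw => by
    have := hR hw
    rw [norm_inv, norm_pow] at this
    exact this.trans (by gcongr; exact le_max_left _ _)
  have hsum : ∀ w : ℂ, 0 < w.re → max R 1 ≤ ‖w‖ → ∀ n : ℕ,
      ‖∏ k ∈ Finset.range n, stirlingStep a (w + k) - 1‖ ≤ Real.exp (4 * C' / ‖w‖) - 1 := by
    intro w hw hRw n
    have h1 := Finset.norm_prod_one_add_sub_one_le (Finset.range n)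
      (fun k : ℕ => stirlingStep a (w + k) - 1)
    simp only [add_sub_cancel] at h1
    refine h1.trans (sub_le_sub_right (Real.exp_le_exp.2 ?_) _)
    have hw1 : 1 ≤ ‖w‖ := (le_max_right _ _).trans hRw
    have hnorm : ∀ k : ℕ, (‖w‖ + k) ^ 2 ≤ 2 * ‖w + k‖ ^ 2 ∧ ‖w‖ ≤ ‖w + k‖ := by
      intro k
      have hk : (0 : ℝ) ≤ k := by positivity
      have e : ‖w + k‖ ^ 2 = ‖w‖ ^ 2 + 2 * w.re * k + k ^ 2 := by
        rw [← Complex.normSq_eq_norm_sq, ← Complex.normSq_eq_norm_sq, Complex.normSq_apply,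
          Complex.normSq_apply]
        simp; ring
      have hwk : 0 ≤ w.re * k := by positivity
      constructor
      · rw [e]; nlinarith [sq_nonneg (‖w‖ - k)]
      · refine le_of_sq_le_sq ?_ (norm_nonneg _)
        rw [e]; nlinarith [sq_nonneg (k : ℝ)]
    calc ∑ k ∈ Finset.range n, ‖stirlingStep a (w + k) - 1‖
        ≤ ∑ k ∈ Finset.range n, 2 * C' * ((‖w‖ + k) ^ 2)⁻¹ := by
          refine Finset.sum_le_sum fun k _ => ?_
          obtain ⟨h2, h3⟩ := hnorm k
          refine (hC' _ (((le_max_left _ _).trans hRw).trans h3)).trans ?_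
          rw [mul_comm 2 C', mul_assoc]
          refine mul_le_mul_of_nonneg_left ?_ (le_max_right _ _)
          have hp : 0 < ‖w‖ := by linarith
          have hp' : 0 < ‖w + k‖ := by linarith
          rw [inv_eq_one_div, ← div_eq_mul_inv, div_le_div_iff₀ (by positivity) (by positivity)]
          linarith
      _ ≤ 2 * C' * (2 / ‖w‖) := by
          rw [← Finset.mul_sum]
          exact mul_le_mul_of_nonneg_left (sum_range_inv_add_sq_le hw1 n)
            (mul_nonneg zero_le_two (le_max_right _ _))
      _ = 4 * C' / ‖w‖ := by ring
  have hlim : ∀ w : ℂ, 0 < w.re → max R 1 ≤ ‖w‖ →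
      ‖stirlingRecip a w - L‖ ≤ ‖L‖ * (Real.exp (4 * C' / ‖w‖) - 1) := by
    intro w hw hRw
    have ht := (((tendsto_stirlingRecip_add_nat a hw).const_sub (stirlingRecip a w)).norm)
    have ht' := ((tendsto_stirlingRecip_add_nat a hw).norm.mul_const
      (Real.exp (4 * C' / ‖w‖) - 1))
    refine le_of_tendsto_of_tendsto' ht ht' fun n => ?_
    rw [stirlingRecip_eq_prod_mul a hw n, ← sub_one_mul, norm_mul, mul_comm]
    exact mul_le_mul_of_nonneg_left (hsum w hw hRw n) (norm_nonneg _)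
  refine Asymptotics.IsBigO.of_bound (‖L‖ * (4 * C' * Real.exp (4 * C'))) ?_
  have hev : ∀ᶠ w : ℂ in Bornology.cobounded ℂ, max R 1 ≤ ‖w‖ :=
    tendsto_norm_cobounded_atTop.eventually_ge_atTop _
  filter_upwards [hev.filter_mono inf_le_left, mem_inf_of_right (mem_principal_self _)] with w h1 h2
  refine (hlim w h2 h1).trans ?_
  rw [mul_assoc]
  refine mul_le_mul_of_nonneg_left ?_ (norm_nonneg _)
  have hw1 : 1 ≤ ‖w‖ := (le_max_right _ _).trans h1
  have hC0 : 0 ≤ C' := le_max_right _ _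
  set x := 4 * C' / ‖w‖ with hx
  have hx1 : x ≤ 4 * C' := div_le_self (by positivity) hw1
  have hx0 : 0 ≤ x := by positivity
  have hexp : Real.exp x - 1 ≤ x * Real.exp x := by
    have h := Real.add_one_le_exp (-x)
    rw [Real.exp_neg] at h
    have hp := Real.exp_pos x
    have := mul_le_mul_of_nonneg_right h hp.le
    rw [inv_mul_cancel₀ hp.ne'] at this
    linarith
  refine hexp.trans ?_
  rw [norm_inv]
  calc x * Real.exp x ≤ x * Real.exp (4 * C') := by gcongr
    _ = 4 * C' * Real.exp (4 * C') * ‖w‖⁻¹ := by rw [hx]; ring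

/-! ### Asymptotics of the Mellin-Barnes kernel -/

/-- The filter of neighbourhoods of infinity in the open right half-plane. -/
noncomputable def rightInfty : Filter ℂ := Bornology.cobounded ℂ ⊓ 𝓟 {w | 0 < w.re}

/-- `f` has the limit `α` at infinity in the right half-plane, with error `O(1 / w)`. -/
def HasLimitAtRightInfty (f : ℂ → ℂ) (α : ℂ) : Prop :=
  (fun w => f w - α) =O[rightInfty] fun w => w⁻¹

theorem tendsto_inv_rightInfty : Tendsto (fun w : ℂ => w⁻¹) rightInfty (𝓝 0) :=
  Filter.tendsto_inv₀_cobounded.mono_left inf_le_left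

namespace HasLimitAtRightInfty

variable {f g : ℂ → ℂ} {α β : ℂ}

theorem tendsto (hf : HasLimitAtRightInfty f α) : Tendsto f rightInfty (𝓝 α) := by
  have := (hf.trans_tendsto tendsto_inv_rightInfty).add_const α
  simpa using this

theorem mul (hf : HasLimitAtRightInfty f α) (hg : HasLimitAtRightInfty g β) :
    HasLimitAtRightInfty (fun w => f w * g w) (α * β) := by
  have h1 : (fun w => (f w - α) * g w) =O[rightInfty] fun w => w⁻¹ := by
    simpa using Asymptotics.IsBigO.mul hf (hg.tendsto.isBigO_one ℂ)
  have h2 : (fun w => α * (g w - β)) =O[rightInfty] fun w => w⁻¹ :=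
    Asymptotics.IsBigO.const_mul_left hg α
  exact (h1.add h2).congr_left fun w => by ring

theorem inv (hf : HasLimitAtRightInfty f α) (hα : α ≠ 0) :
    HasLimitAtRightInfty (fun w => (f w)⁻¹) α⁻¹ := by
  have h1 : (fun w => -(f w - α) * ((f w)⁻¹ * α⁻¹)) =O[rightInfty] fun w => w⁻¹ := by
    simpa using (Asymptotics.IsBigO.neg_left hf).mul
      (((hf.tendsto.inv₀ hα).mul_const α⁻¹).isBigO_one ℂ)
  refine h1.congr' ?_ (by rfl)
  filter_upwards [hf.tendsto.eventually_ne hα] with w hw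
  field_simp
  ring

theorem prod {ι : Type*} (s : Finset ι) {f : ι → ℂ → ℂ} {α : ι → ℂ}
    (h : ∀ i ∈ s, HasLimitAtRightInfty (f i) (α i)) :
    HasLimitAtRightInfty (fun w => ∏ i ∈ s, f i w) (∏ i ∈ s, α i) := by
  classical
  induction s using Finset.induction_on with
  | empty => simpa [HasLimitAtRightInfty] using Asymptotics.isBigO_zero _ _
  | insert i s hi ih =>
    simp only [Finset.prod_insert hi]
    exact (h i (Finset.mem_insert_self _ _)).mul (ih fun j hj => h j (Finset.mem_insert_of_mem hj))

theorem comp_mul {A : ℝ} (hA : 0 < A) (hf : HasLimitAtRightInfty f α) :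
    HasLimitAtRightInfty (fun w => f (A * w)) α := by
  have hA0 : (A : ℂ) ≠ 0 := by exact_mod_cast hA.ne'
  have ht : Tendsto (fun w : ℂ => (A : ℂ) * w) rightInfty rightInfty := by
    refine tendsto_inf.2 ⟨(tendsto_mul_left_cobounded hA0).mono_left inf_le_left, ?_⟩
    refine tendsto_principal.2 (mem_inf_of_right ?_)
    intro w hw
    simpa using mul_pos hA hw
  refine (Asymptotics.IsBigO.comp_tendsto hf ht).trans ?_
  refine ((Asymptotics.isBigO_refl (fun w : ℂ => w⁻¹) _).const_mul_left (A : ℂ)⁻¹).congr_left ?_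
  intro w; simp [Function.comp, mul_comm]

end HasLimitAtRightInfty

/-- On a closed half-plane a continuous function with power decay at infinity obeys the decay bound
everywhere, by compactness of the remaining region. -/
theorem exists_forall_norm_le_rpow_of_isBigO {f : ℂ → ℂ} {ν : ℝ} (hν : 0 ≤ ν)
    (hf : ContinuousOn f {s | 1 ≤ s.re}) (h : f =O[rightInfty] fun s => ‖s‖ ^ (-ν)) :
    ∃ M : ℝ, 0 ≤ M ∧ ∀ s : ℂ, 1 ≤ s.re → ‖f s‖ ≤ M * ‖s‖ ^ (-ν) := by
  obtain ⟨C, hC⟩ := h.bound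
  have hC' := eventually_inf_principal.1 hC
  obtain ⟨R, -, hR⟩ := (Filter.hasBasis_cobounded_norm (E := ℂ)).eventually_iff.1 hC'
  have hcomp : IsCompact ({s : ℂ | 1 ≤ s.re} ∩ Metric.closedBall 0 R) :=
    (isCompact_closedBall (0 : ℂ) R).inter_left (isClosed_le continuous_const Complex.continuous_re)
  obtain ⟨D, hD⟩ := hcomp.exists_bound_of_continuousOn (hf.mono Set.inter_subset_left)
  have hR1 : 0 < max R 1 ^ ν := Real.rpow_pos_of_pos (lt_max_of_lt_right one_pos) _
  refine ⟨max C 0 + max D 0 * max R 1 ^ ν, by positivity, fun s hs => ?_⟩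
  have hs1 : 1 ≤ ‖s‖ := hs.trans (Complex.re_le_norm s)
  have hpos : 0 < ‖s‖ ^ (-ν) := by positivity
  have hD0 : 0 ≤ max D 0 := le_max_right _ _
  rw [add_mul]
  rcases le_total R ‖s‖ with h1 | h1
  · have := hR h1 (show 0 < s.re by linarith)
    rw [Real.norm_of_nonneg hpos.le] at this
    have h2 : C * ‖s‖ ^ (-ν) ≤ max C 0 * ‖s‖ ^ (-ν) :=
      mul_le_mul_of_nonneg_right (le_max_left _ _) hpos.le
    have h3 : 0 ≤ max D 0 * max R 1 ^ ν * ‖s‖ ^ (-ν) := by positivity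
    linarith
  · have h2 := hD s ⟨hs, by simpa using h1⟩
    have h3 : 1 ≤ max R 1 ^ ν * ‖s‖ ^ (-ν) := by
      rw [Real.rpow_neg (by positivity), ← div_eq_mul_inv, one_le_div (by positivity)]
      exact Real.rpow_le_rpow (by positivity) (h1.trans (le_max_left _ _)) hν
    have h4 : 0 ≤ max C 0 * ‖s‖ ^ (-ν) := by positivity
    have h5 := mul_le_mul_of_nonneg_left h3 hD0
    rw [mul_one, ← mul_assoc] at h5
    linarith [le_max_left D 0]

section Kernel

variable {p q : ℕ} {a A : Fin p → ℝ} {b B : Fin q → ℝ}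

theorem foxRho_pos (hA : ∀ j, 0 < A j) (hB : ∀ j, 0 < B j) : 0 < foxRho A B :=
  mul_pos (Finset.prod_pos fun i _ => Real.rpow_pos_of_pos (hA i) _)
    (Finset.prod_pos fun i _ => Real.rpow_pos_of_pos (hB i) _)

theorem log_foxRho (hA : ∀ j, 0 < A j) (hB : ∀ j, 0 < B j) :
    Real.log (foxRho A B) = ∑ j, A j * Real.log (A j) - ∑ k, B k * Real.log (B k) := by
  have h1 : ∀ i ∈ Finset.univ, A i ^ A i ≠ 0 := fun i _ => (Real.rpow_pos_of_pos (hA i) _).ne'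
  have h2 : ∀ i ∈ Finset.univ, B i ^ (-B i) ≠ 0 := fun i _ => (Real.rpow_pos_of_pos (hB i) _).ne'
  rw [foxRho, Real.log_mul (Finset.prod_ne_zero_iff.2 h1) (Finset.prod_ne_zero_iff.2 h2),
    Real.log_prod h1, Real.log_prod h2, sub_eq_add_neg, ← Finset.sum_neg_distrib]
  congr 1
  · exact Finset.sum_congr rfl fun i _ => Real.log_rpow (hA i) _
  · exact Finset.sum_congr rfl fun i _ => by rw [Real.log_rpow (hB i), neg_mul]

theorem re_pos_of_neg_foxGamma_lt (hA : ∀ j, 0 < A j) {s : ℂ} (hs : -foxGamma a A < s.re)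
    (j : Fin p) : 0 < ((A j : ℂ) * s + a j).re := by
  have h : foxGamma a A ≤ a j / A j := ciInf_le (Set.finite_range _).bddBelow j
  have h1 : -(a j / A j) < s.re := by linarith
  have h2 : -a j < A j * s.re := by
    have := mul_lt_mul_of_pos_left h1 (hA j)
    rwa [mul_neg, mul_div_cancel₀ _ (hA j).ne'] at this
  simp; linarith

theorem differentiableAt_foxKernel (hA : ∀ j, 0 < A j) {s : ℂ} (hs : -foxGamma a A < s.re) :
    DifferentiableAt ℂ (foxKernel a A b B) s := by
  have h1 : ∀ j, DifferentiableAt ℂ (fun s : ℂ => Complex.Gamma ((A j : ℂ) * s + a j)) s := by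
    intro j
    refine DifferentiableAt.comp (g := Complex.Gamma) s
      (Complex.differentiableAt_Gamma _ fun m h => ?_) (by fun_prop)
    have := re_pos_of_neg_foxGamma_lt (a := a) hA hs j
    rw [h] at this
    simp at this
    linarith [(Nat.cast_nonneg m : (0 : ℝ) ≤ m)]
  have h2 : ∀ k, DifferentiableAt ℂ (fun s : ℂ => (Complex.Gamma ((B k : ℂ) * s + b k))⁻¹) s :=
    fun k => DifferentiableAt.comp (g := fun s => (Complex.Gamma s)⁻¹) s
      (Complex.differentiable_one_div_Gamma _) (by fun_prop)
  have e : foxKernel a A b B = fun s => (∏ j, Complex.Gamma ((A j : ℂ) * s + a j)) *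
      ∏ k, (Complex.Gamma ((B k : ℂ) * s + b k))⁻¹ := by
    ext s; rw [foxKernel, div_eq_mul_inv, Finset.prod_inv_distrib]
  rw [e]
  exact (DifferentiableAt.fun_finsetProd fun j _ => h1 j).mul
    (DifferentiableAt.fun_finsetProd fun k _ => h2 k)

/-- The normalised kernel is the kernel divided by `ρ ^ s * s ^ (-μ)`, up to a constant: the terms
`s log s` cancel because `∑ A = ∑ B`. -/
theorem exists_prod_stirlingRecip_eq (hA : ∀ j, 0 < A j) (hB : ∀ j, 0 < B j)
    (hAB : ∑ j, A j = ∑ j, B j) (d : ℝ) :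
    ∃ κ : ℂ, ∀ s : ℂ, s ≠ 0 →
      (∏ j, (stirlingRecip ((a j - A j * d : ℝ) : ℂ) (A j * s))⁻¹) *
        ∏ k, stirlingRecip ((b k - B k * d : ℝ) : ℂ) (B k * s) =
      foxKernel a A b B (s - d) *
        Complex.exp (-(s - d) * Real.log (foxRho A B) + foxMu a b * Complex.log s + κ) := by
  refine ⟨-d * Real.log (foxRho A B) - ∑ j, (a j - A j * d - 1 / 2) * Real.log (A j) +
    ∑ k, (b k - B k * d - 1 / 2) * Real.log (B k), fun s hs => ?_⟩
  have hlog : ∀ {x : ℝ}, 0 < x → Complex.log (x * s) = Real.log x + Complex.log s :=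
    fun hx => Complex.log_ofReal_mul hx hs
  have e1 : ∀ j, (stirlingRecip ((a j - A j * d : ℝ) : ℂ) (A j * s))⁻¹ =
      Complex.Gamma (A j * (s - d) + a j) *
        Complex.exp (A j * s - (A j * s + (a j - A j * d) - 1 / 2) *
          (Real.log (A j) + Complex.log s)) := by
    intro j
    rw [stirlingRecip, mul_inv, inv_inv, ← Complex.exp_neg, hlog (hA j)]
    push_cast
    congr 2 <;> ring
  have e2 : ∀ k, stirlingRecip ((b k - B k * d : ℝ) : ℂ) (B k * s) =
      (Complex.Gamma (B k * (s - d) + b k))⁻¹ *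
        Complex.exp ((B k * s + (b k - B k * d) - 1 / 2) *
          (Real.log (B k) + Complex.log s) - B k * s) := by
    intro k
    rw [stirlingRecip, hlog (hB k)]
    push_cast
    congr 3; ring
  simp only [e1, e2, Finset.prod_mul_distrib, ← Complex.exp_sum, Finset.prod_inv_distrib]
  have hk : foxKernel a A b B (s - d) = (∏ j, Complex.Gamma (A j * (s - d) + a j)) *
      (∏ k, Complex.Gamma (B k * (s - d) + b k))⁻¹ := div_eq_mul_inv _ _
  have hAB' : ∑ j, (A j : ℂ) = ∑ j, (B j : ℂ) := by exact_mod_cast hAB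
  have hρ : ((Real.log (foxRho A B) : ℝ) : ℂ) =
      ∑ j, (A j : ℂ) * Real.log (A j) - ∑ k, (B k : ℂ) * Real.log (B k) := by
    rw [log_foxRho hA hB]; push_cast; rfl
  have s1 : ∑ j, ((A j : ℂ) * s - (A j * s + (a j - A j * d) - 1 / 2) *
      (Real.log (A j) + Complex.log s)) =
      (∑ j, (A j : ℂ)) * (s - (s - d) * Complex.log s) - (∑ j, (a j : ℂ)) * Complex.log s
        + p / 2 * Complex.log s - s * (∑ j, (A j : ℂ) * Real.log (A j))
        - ∑ j, (a j - A j * d - 1 / 2) * (Real.log (A j) : ℂ) := by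
    have : (p : ℂ) / 2 * Complex.log s = ∑ j : Fin p, 1 / 2 * Complex.log s := by
      simp; ring
    rw [this, Finset.sum_mul, Finset.sum_mul, Finset.mul_sum, ← Finset.sum_sub_distrib,
      ← Finset.sum_add_distrib, ← Finset.sum_sub_distrib, ← Finset.sum_sub_distrib]
    exact Finset.sum_congr rfl fun j _ => by ring
  have s2 : ∑ k, (((B k : ℂ) * s + (b k - B k * d) - 1 / 2) *
      (Real.log (B k) + Complex.log s) - B k * s) =
      -((∑ j, (B j : ℂ)) * (s - (s - d) * Complex.log s)) + (∑ j, (b j : ℂ)) * Complex.log s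
        - q / 2 * Complex.log s + s * (∑ j, (B j : ℂ) * Real.log (B j))
        + ∑ j, (b j - B j * d - 1 / 2) * (Real.log (B j) : ℂ) := by
    have : (q : ℂ) / 2 * Complex.log s = ∑ j : Fin q, 1 / 2 * Complex.log s := by
      simp; ring
    rw [this, Finset.sum_mul, Finset.sum_mul, Finset.mul_sum, ← Finset.sum_neg_distrib,
      ← Finset.sum_add_distrib, ← Finset.sum_sub_distrib, ← Finset.sum_add_distrib,
      ← Finset.sum_add_distrib]
    exact Finset.sum_congr rfl fun j _ => by ring
  rw [mul_mul_mul_comm, ← Complex.exp_add, s1, s2, hk, hAB', hρ, foxMu]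
  congr 2
  push_cast
  ring

/-- The kernel is `C₀ ρ ^ s (s + d) ^ (-μ) (1 + O(1 / s))` in a half-plane to the right of all its
poles. The shift `d = 1 - c₀` keeps `s + d` away from the branch cut. -/
theorem exists_foxKernel_sub_le (hA : ∀ j, 0 < A j) (hB : ∀ j, 0 < B j)
    (hAB : ∑ j, A j = ∑ j, B j) (hμ : 0 < foxMu a b) {c₀ : ℝ} (hc₀ : -foxGamma a A < c₀) :
    ∃ (C₀ : ℂ) (M : ℝ), 0 ≤ M ∧ ∀ s : ℂ, c₀ ≤ s.re →
      ‖foxKernel a A b B s * Complex.exp (-s * Real.log (foxRho A B)) -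
        C₀ * (s + (1 - c₀ : ℝ)) ^ (-foxMu a b : ℂ)‖ ≤
      M * ‖s + (1 - c₀ : ℝ)‖ ^ (-(foxMu a b + 1)) := by
  set d : ℝ := 1 - c₀ with hd
  set μ := foxMu a b
  -- The shifted parameters `a_j - A_j d`, `b_k - B_k d` express the kernel at `s - d` through `s`.
  obtain ⟨κ, hκ⟩ := exists_prod_stirlingRecip_eq (a := a) (b := b) hA hB hAB d
  set L : ℂ := (√Real.pi : ℂ)⁻¹ * (√2 : ℂ)⁻¹ with hL
  have hL0 : L ≠ 0 := by
    have h1 : √Real.pi ≠ 0 := by positivity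
    have h2 : √(2 : ℝ) ≠ 0 := by positivity
    rw [hL]
    exact mul_ne_zero (inv_ne_zero (by exact_mod_cast h1)) (inv_ne_zero (by exact_mod_cast h2))
  have hst : ∀ a : ℂ, HasLimitAtRightInfty (stirlingRecip a) L := isBigO_stirlingRecip
  have hlim := (HasLimitAtRightInfty.prod Finset.univ (f := fun j s =>
      (stirlingRecip ((a j - A j * d : ℝ) : ℂ) (A j * s))⁻¹) (α := fun _ => L⁻¹)
      fun j _ => ((hst _).comp_mul (hA j)).inv hL0).mul
    (HasLimitAtRightInfty.prod Finset.univ (f := fun k s =>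
      stirlingRecip ((b k - B k * d : ℝ) : ℂ) (B k * s)) (α := fun _ => L)
      fun k _ => (hst _).comp_mul (hB k))
  set α : ℂ := (∏ _j : Fin p, L⁻¹) * ∏ _k : Fin q, L
  set G : ℂ → ℂ := fun s => foxKernel a A b B (s - d) *
    Complex.exp (-(s - d) * Real.log (foxRho A B)) - Complex.exp (-κ) * α * s ^ (-μ : ℂ) with hG
  have hne : ∀ᶠ s : ℂ in rightInfty, 0 < s.re := mem_inf_of_right (mem_principal_self _)
  have hnorm : ∀ {s : ℂ}, s ≠ 0 → ‖s ^ (-μ : ℂ)‖ = ‖s‖ ^ (-μ) := fun {s} hs => by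
    rw [← Complex.ofReal_neg, Complex.norm_cpow_real]
  have hO : G =O[rightInfty] fun s => ‖s‖ ^ (-(μ + 1)) := by
    have h1 := (Asymptotics.isBigO_refl (fun s : ℂ => Complex.exp (-κ) * s ^ (-μ : ℂ))
      rightInfty).mul hlim
    have h2 : (fun s : ℂ => Complex.exp (-κ) * s ^ (-μ : ℂ) * s⁻¹) =O[rightInfty]
        fun s => ‖s‖ ^ (-(μ + 1)) := by
      refine Asymptotics.IsBigO.of_bound ‖Complex.exp (-κ)‖ ?_
      filter_upwards [hne] with s hs
      have h0 : s ≠ 0 := by rintro rfl; simp at hs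
      have hp : 0 < ‖s‖ := norm_pos_iff.2 h0
      rw [norm_mul, norm_mul, hnorm h0, norm_inv, Real.norm_of_nonneg (by positivity), neg_add,
        Real.rpow_add hp, Real.rpow_neg_one, mul_assoc]
    refine (h1.trans h2).congr' ?_ (by rfl)
    filter_upwards [hne] with s hs
    have h0 : s ≠ 0 := by rintro rfl; simp at hs
    rw [hκ s h0, Complex.cpow_def_of_ne_zero h0, hG]
    simp only
    rw [Complex.cpow_def_of_ne_zero h0, mul_sub, Complex.exp_add, Complex.exp_add]
    have e1 : Complex.exp (-κ) * Complex.exp κ = 1 := by rw [← Complex.exp_add]; simp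
    have e2 : Complex.exp (Complex.log s * -(μ : ℂ)) * Complex.exp (μ * Complex.log s) = 1 := by
      rw [← Complex.exp_add]; ring_nf; simp
    linear_combination (foxKernel a A b B (s - d) *
      Complex.exp (-(s - d) * Real.log (foxRho A B))) *
      (e1 + Complex.exp (-κ) * Complex.exp κ * e2)
  have hcont : ContinuousOn G {s | 1 ≤ s.re} := by
    intro s hs
    have hs' : 1 ≤ s.re := hs
    refine ContinuousAt.continuousWithinAt ?_
    have h1 : ContinuousAt (foxKernel a A b B) (s - d) :=
      (differentiableAt_foxKernel hA (by simp [hd]; linarith)).continuousAt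
    have h2 : ContinuousAt (fun s : ℂ => foxKernel a A b B (s - d)) s :=
      ContinuousAt.comp (f := fun s : ℂ => s - d) h1 (by fun_prop)
    refine (h2.mul (by fun_prop)).sub (continuousAt_const.mul ?_)
    exact continuousAt_id.cpow continuousAt_const (Or.inl (by simp; linarith))
  obtain ⟨M, hM0, hM⟩ := exists_forall_norm_le_rpow_of_isBigO (by linarith) hcont hO
  refine ⟨Complex.exp (-κ) * α, M, hM0, fun s hs => ?_⟩
  have := hM (s + d) (by simp [hd]; linarith)
  simpa [hG] using this

end Kernel

/-! ### Inverse Laplace transforms along vertical lines -/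

/-- The inverse Laplace integral `(1 / 2πi) ∫ exp (x s) F(s) ds` along the line `Re s = c`. -/
noncomputable def vertInv (F : ℂ → ℂ) (c x : ℝ) : ℂ :=
  (2 * Real.pi : ℂ)⁻¹ * ∫ y : ℝ, Complex.exp (x * (c + y * Complex.I)) * F (c + y * Complex.I)

open FourierTransform in
theorem fourierInv_comp_vertical (F : ℂ → ℂ) (c x : ℝ) :
    𝓕⁻ (fun y : ℝ => F (c + (2 * Real.pi * y : ℝ) * Complex.I)) x =
      Complex.exp (-(c * x)) * vertInv F c x := by
  have h := MeasureTheory.Measure.integral_comp_mul_left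
    (fun y : ℝ => Complex.exp (y * x * Complex.I) * F (c + y * Complex.I)) (2 * Real.pi)
  rw [abs_of_pos (by positivity), Complex.real_smul] at h
  rw [Real.fourierInv_eq', vertInv, mul_left_comm, ← integral_const_mul]
  have e : ∀ y : ℝ, Complex.exp (-(c * x)) * (Complex.exp (x * (c + y * Complex.I)) *
      F (c + y * Complex.I)) = Complex.exp (y * x * Complex.I) * F (c + y * Complex.I) := by
    intro y
    rw [← mul_assoc, ← Complex.exp_add]
    congr 2; ring
  simp only [e]
  push_cast at h
  rw [← h]
  congr 1
  ext y
  simp [mul_assoc, mul_left_comm, mul_comm]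

open FourierTransform in
theorem continuous_fourierInv_of_integrable {f : ℝ → ℂ} (hf : Integrable f) : Continuous (𝓕⁻ f) := by
  have h : Continuous (𝓕 f) :=
    VectorFourier.fourierIntegral_continuous Real.continuous_fourierChar
      (by fun_prop) hf
  have e : 𝓕⁻ f = fun x => 𝓕 f (-x) := by
    ext x; exact Real.fourierInv_eq_fourier_neg f x
  rw [e]
  exact h.comp continuous_neg

theorem norm_add_mul_I_sq (c y : ℝ) : ‖(c + y * Complex.I : ℂ)‖ ^ 2 = c ^ 2 + y ^ 2 := by
  rw [← Complex.normSq_eq_norm_sq, Complex.normSq_apply]; simp; ring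

theorem norm_rpow_neg_vertical_le {c ν : ℝ} (hc : 1 ≤ c) (hν : 0 ≤ ν) (y : ℝ) :
    ‖(c + y * Complex.I : ℂ)‖ ^ (-ν) ≤ (1 + ‖y‖ ^ 2) ^ (-ν / 2) := by
  have h1 : (1 + ‖y‖ ^ 2 : ℝ) ≤ ‖(c + y * Complex.I : ℂ)‖ ^ 2 := by
    rw [norm_add_mul_I_sq, Real.norm_eq_abs, sq_abs]; nlinarith
  have h2 : ‖(c + y * Complex.I : ℂ)‖ ^ (-ν) = (‖(c + y * Complex.I : ℂ)‖ ^ 2) ^ (-ν / 2) := by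
    rw [← Real.rpow_natCast, ← Real.rpow_mul (norm_nonneg _)]
    congr 1; push_cast; ring
  rw [h2]
  exact Real.rpow_le_rpow_of_nonpos (by positivity) h1 (by linarith)

theorem integrable_vertical_weight {ν : ℝ} (hν : 1 < ν) :
    Integrable (fun y : ℝ => (1 + ‖y‖ ^ 2) ^ (-ν / 2)) :=
  integrable_rpow_neg_one_add_norm_sq (by simpa using hν)

/-- A function holomorphic on the closed half-plane `c₀ ≤ Re s` with power decay `O(|s|^(-ν))`,
`ν > 1`, normalised so that `s + (1 - c₀)` has real part at least `1`. -/
structure HasHalfPlaneDecay (F : ℂ → ℂ) (c₀ ν M : ℝ) : Prop where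
  one_lt : 1 < ν
  nonneg : 0 ≤ M
  diff : ∀ s : ℂ, c₀ ≤ s.re → DifferentiableAt ℂ F s
  bound : ∀ s : ℂ, c₀ ≤ s.re → ‖F s‖ ≤ M * ‖s + (1 - c₀ : ℝ)‖ ^ (-ν)

namespace HasHalfPlaneDecay

variable {F : ℂ → ℂ} {c₀ ν M : ℝ} (h : HasHalfPlaneDecay F c₀ ν M)
include h

theorem norm_vertical_le {c : ℝ} (hc : c₀ ≤ c) (y : ℝ) :
    ‖F (c + y * Complex.I)‖ ≤ M * (1 + ‖y‖ ^ 2) ^ (-ν / 2) := by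
  refine (h.bound _ (by simpa using hc)).trans (mul_le_mul_of_nonneg_left ?_ h.nonneg)
  have e : (c + y * Complex.I + (1 - c₀ : ℝ) : ℂ) = ((c + (1 - c₀) : ℝ) : ℂ) + y * Complex.I := by
    push_cast; ring
  rw [e]
  exact norm_rpow_neg_vertical_le (by linarith) (by linarith [h.one_lt]) y

theorem continuous_vertical {c : ℝ} (hc : c₀ ≤ c) :
    Continuous fun y : ℝ => F (c + y * Complex.I) := by
  rw [continuous_iff_continuousAt]
  intro y
  exact ContinuousAt.comp (f := fun y : ℝ => (c + y * Complex.I : ℂ)) (g := F)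
    (h.diff _ (by simpa using hc)).continuousAt (by fun_prop)

theorem integrable_vertical {c : ℝ} (hc : c₀ ≤ c) :
    Integrable fun y : ℝ => F (c + y * Complex.I) :=
  ((integrable_vertical_weight h.one_lt).const_mul M).mono'
    (h.continuous_vertical hc).aestronglyMeasurable
    (Eventually.of_forall (h.norm_vertical_le hc))

theorem norm_exp_mul_vertical_le {c : ℝ} (hc : c₀ ≤ c) (x y : ℝ) :
    ‖Complex.exp (x * (c + y * Complex.I)) * F (c + y * Complex.I)‖ ≤
      Real.exp (c * x) * (M * (1 + ‖y‖ ^ 2) ^ (-ν / 2)) := by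
  rw [norm_mul, Complex.norm_exp]
  have : ((x : ℂ) * (c + y * Complex.I)).re = c * x := by simp [mul_comm]
  rw [this]
  exact mul_le_mul_of_nonneg_left (h.norm_vertical_le hc y) (Real.exp_nonneg _)

theorem integrable_exp_mul_vertical {c : ℝ} (hc : c₀ ≤ c) (x : ℝ) :
    Integrable fun y : ℝ => Complex.exp (x * (c + y * Complex.I)) * F (c + y * Complex.I) := by
  refine (((integrable_vertical_weight h.one_lt).const_mul M).const_mul (Real.exp (c * x))).mono'
    ?_ (Eventually.of_forall (h.norm_exp_mul_vertical_le hc x))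
  exact (Continuous.mul (by fun_prop) (h.continuous_vertical hc)).aestronglyMeasurable

theorem norm_vertInv_le {c : ℝ} (hc : c₀ ≤ c) (x : ℝ) :
    ‖vertInv F c x‖ ≤ ((2 * Real.pi)⁻¹ * M * ∫ y : ℝ, (1 + ‖y‖ ^ 2) ^ (-ν / 2)) *
      Real.exp (c * x) := by
  have h1 := norm_integral_le_of_norm_le
    (((integrable_vertical_weight h.one_lt).const_mul M).const_mul (Real.exp (c * x)))
    (Eventually.of_forall (h.norm_exp_mul_vertical_le hc x))
  rw [integral_const_mul, integral_const_mul] at h1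
  have h2 : ‖(2 * Real.pi : ℂ)⁻¹‖ = (2 * Real.pi)⁻¹ := by
    rw [← Complex.ofReal_ofNat, ← Complex.ofReal_mul, ← Complex.ofReal_inv, Complex.norm_real,
      Real.norm_of_nonneg (by positivity)]
  rw [vertInv, norm_mul, h2]
  calc _ ≤ (2 * Real.pi)⁻¹ * _ := mul_le_mul_of_nonneg_left h1 (by positivity)
    _ = _ := by ring

/-- Cauchy's theorem on the rectangles `[c₀, c] × [-T, T]`, `T → ∞`: the inverse Laplace integral
does not depend on the line. -/
theorem vertInv_eq {c : ℝ} (hc : c₀ ≤ c) (x : ℝ) : vertInv F c x = vertInv F c₀ x := by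
  rw [vertInv, vertInv]
  congr 1
  set G : ℂ → ℂ := fun s => Complex.exp (x * s) * F s with hG
  have hGd : ∀ s : ℂ, c₀ ≤ s.re → DifferentiableAt ℂ G s := fun s hs =>
    DifferentiableAt.mul (by fun_prop) (h.diff s hs)
  set K := Real.exp (max c₀ c * |x|) with hK
  have hrect : ∀ T : ℝ,
      (∫ u : ℝ in c₀..c, G (u + (-T : ℝ) * Complex.I)) - (∫ u : ℝ in c₀..c, G (u + T * Complex.I)) +
      Complex.I • (∫ y : ℝ in (-T)..T, G (c + y * Complex.I)) -
      Complex.I • (∫ y : ℝ in (-T)..T, G (c₀ + y * Complex.I)) = 0 := by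
    intro T
    have := Complex.integral_boundary_rect_eq_zero_of_differentiableOn G
      (c₀ + (-T : ℝ) * Complex.I) (c + T * Complex.I) (by
        intro s hs
        have hs1 := (Complex.mem_reProdIm.1 hs).1
        simp [Set.uIcc_of_le hc] at hs1
        exact (hGd s hs1.1).differentiableWithinAt)
    simpa using this
  have hw : Tendsto (fun T : ℝ => (1 + ‖T‖ ^ 2) ^ (-ν / 2)) atTop (𝓝 0) := by
    have h1 : Tendsto (fun T : ℝ => 1 + ‖T‖ ^ 2) atTop atTop :=
      tendsto_atTop_add_const_left _ _
        ((tendsto_pow_atTop two_ne_zero).comp tendsto_norm_atTop_atTop)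
    have h2 := (tendsto_rpow_neg_atTop (show 0 < ν / 2 by linarith [h.one_lt])).comp h1
    refine h2.congr fun T => ?_
    simp only [Function.comp]; congr 1; ring
  obtain ⟨D, hD⟩ := (isCompact_Icc (a := c₀) (b := c)).exists_bound_of_continuousOn
    (f := fun u : ℝ => Real.exp (u * x)) (by fun_prop)
  have hhor : ∀ (ε : ℝ), |ε| = 1 →
      Tendsto (fun T : ℝ => ∫ u : ℝ in c₀..c, G (u + (ε * T : ℝ) * Complex.I)) atTop (𝓝 0) := by
    intro ε hε
    have hlim : Tendsto (fun T : ℝ => D * (M * (1 + ‖T‖ ^ 2) ^ (-ν / 2)) * |c - c₀|) atTop (𝓝 0) := by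
      simpa using ((hw.const_mul M).const_mul D).mul_const |c - c₀|
    refine squeeze_zero_norm (fun T => ?_) hlim
    refine intervalIntegral.norm_integral_le_of_norm_le_const fun u hu => ?_
    rw [Set.uIoc_of_le hc] at hu
    refine (h.norm_exp_mul_vertical_le hu.1.le x (ε * T)).trans ?_
    have e : ‖ε * T‖ = ‖T‖ := by rw [norm_mul, Real.norm_eq_abs, hε, one_mul]
    rw [e]
    have := hD u ⟨hu.1.le, hu.2⟩
    rw [Real.norm_of_nonneg (Real.exp_nonneg _)] at this
    have hM := h.nonneg
    gcongr
  have hver : ∀ {c : ℝ}, c₀ ≤ c → Tendsto (fun T : ℝ => ∫ y : ℝ in (-T)..T, G (c + y * Complex.I))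
      atTop (𝓝 (∫ y : ℝ, G (c + y * Complex.I))) := fun hc =>
    intervalIntegral_tendsto_integral (h.integrable_exp_mul_vertical hc x)
      tendsto_neg_atTop_atBot tendsto_id
  have hl := (((hhor (-1) (by simp)).sub (hhor 1 (by simp))).add
    ((hver hc).const_smul Complex.I)).sub ((hver le_rfl).const_smul Complex.I)
  have hz : (∫ y : ℝ, G (c + y * Complex.I)) - ∫ y : ℝ, G (c₀ + y * Complex.I) = 0 := by
    have := tendsto_nhds_unique (hl.congr fun T => by simpa using hrect T) tendsto_const_nhds
    simp only [sub_self, zero_add, smul_eq_mul, ← mul_sub, mul_eq_zero, Complex.I_ne_zero,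
      false_or] at this
    exact this
  exact sub_eq_zero.1 hz

/-- For `x < 0` the factor `exp (c x)` tends to zero as the line moves to the right. -/
theorem vertInv_eq_zero_of_neg {x : ℝ} (hx : x < 0) : vertInv F c₀ x = 0 := by
  set D := ((2 * Real.pi)⁻¹ * M * ∫ y : ℝ, (1 + ‖y‖ ^ 2) ^ (-ν / 2))
  have h1 : ∀ᶠ c : ℝ in atTop, ‖vertInv F c₀ x‖ ≤ D * Real.exp (c * x) := by
    filter_upwards [eventually_ge_atTop c₀] with c hc
    rw [← h.vertInv_eq hc x]
    exact h.norm_vertInv_le hc x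
  have h2 : Tendsto (fun c : ℝ => D * Real.exp (c * x)) atTop (𝓝 0) := by
    have : Tendsto (fun c : ℝ => c * x) atTop atBot := tendsto_id.atTop_mul_const_of_neg hx
    simpa using (Real.tendsto_exp_atBot.comp this).const_mul D
  exact norm_le_zero_iff.1 (ge_of_tendsto h2 h1)

open FourierTransform in
/-- Fourier inversion on the line `Re s = σ`: `F` is the Laplace transform of its inverse Laplace
integral, which is supported on `x ≥ 0`. -/
theorem laplace_vertInv {σ : ℝ} (hσ : c₀ < σ) :
    IntegrableOn (fun x : ℝ => Complex.exp (-(σ * x)) * vertInv F c₀ x) (Set.Ioi 0) ∧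
    ∫ x in Set.Ioi (0 : ℝ), Complex.exp (-(σ * x)) * vertInv F c₀ x = F σ := by
  set f : ℝ → ℂ := fun y => F (σ + (2 * Real.pi * y : ℝ) * Complex.I) with hf
  have hfc : Continuous f := (h.continuous_vertical hσ.le).comp (by fun_prop)
  have hfi : Integrable f := by
    have := (h.integrable_vertical hσ.le).comp_mul_left' (R := 2 * Real.pi) (by positivity)
    exact this
  have hinv : 𝓕⁻ f = fun x : ℝ => Complex.exp (-(σ * x)) * vertInv F c₀ x := by
    ext x
    rw [fourierInv_comp_vertical, h.vertInv_eq hσ.le]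
  set D := ((2 * Real.pi)⁻¹ * M * ∫ y : ℝ, (1 + ‖y‖ ^ 2) ^ (-ν / 2))
  have hIoi : IntegrableOn (𝓕⁻ f) (Set.Ioi 0) := by
    have h1 : IntegrableOn (fun x : ℝ => D * Real.exp (-(σ - c₀) * x)) (Set.Ioi 0) :=
      (integrableOn_exp_mul_Ioi (by linarith) 0).const_mul D
    refine h1.mono' (continuous_fourierInv_of_integrable hfi).aestronglyMeasurable
      (Eventually.of_forall fun x => ?_)
    rw [hinv]
    simp only
    rw [norm_mul, Complex.norm_exp]
    have e : (-((σ : ℂ) * x)).re = -(σ * x) := by simp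
    rw [e]
    refine (mul_le_mul_of_nonneg_left (h.norm_vertInv_le le_rfl x) (Real.exp_nonneg _)).trans ?_
    rw [mul_left_comm, ← Real.exp_add]
    apply le_of_eq
    congr 2; ring
  have hzero : ∀ x < 0, 𝓕⁻ f x = 0 := fun x hx => by
    rw [hinv]; simp [h.vertInv_eq_zero_of_neg hx]
  have hIio : ∀ᵐ x : ℝ, x ∉ Set.Ioi (0 : ℝ) → 𝓕⁻ f x = 0 := by
    have : ∀ᵐ x : ℝ, x ≠ 0 := Measure.ae_ne volume 0
    filter_upwards [this] with x hx hx'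
    exact hzero x (lt_of_le_of_ne (not_lt.1 hx') hx)
  have hint : Integrable (𝓕⁻ f) := by
    refine (integrableOn_iff_integrable_of_support_subset (s := Set.Ici 0) ?_).1
      (hIoi.congr_set_ae Ioi_ae_eq_Ici.symm)
    intro x hx
    by_contra hx'
    exact hx (hzero x (not_le.1 hx'))
  have hF := congrFun (hfc.fourier_fourierInv_eq hfi (by
    have e : 𝓕 f = fun x => 𝓕⁻ f (-x) := by
      ext x; rw [Real.fourierInv_eq_fourier_neg, neg_neg]
    rw [e]; exact hint.comp_neg)) 0
  rw [Real.fourier_eq'] at hF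
  simp only [inner_zero_right, mul_zero, Complex.ofReal_zero, zero_mul, Complex.exp_zero,
    one_smul] at hF
  refine ⟨by rw [← hinv]; exact hIoi, ?_⟩
  rw [← hinv, setIntegral_eq_integral_of_ae_compl_eq_zero hIio, hF]
  simp [hf]

end HasHalfPlaneDecay

/-! ### Powers and the Gamma integral -/

theorem integrableOn_rpow_mul_exp_neg_mul {ν r : ℝ} (hν : 0 < ν) (hr : 0 < r) :
    IntegrableOn (fun x : ℝ => x ^ (ν - 1) * Real.exp (-(r * x))) (Set.Ioi 0) := by
  have := integrableOn_rpow_mul_exp_neg_mul_rpow (p := 1) (s := ν - 1) (b := r) (by linarith)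
    one_pos hr
  refine this.congr_fun (fun x _ => ?_) measurableSet_Ioi
  simp

theorem norm_rpow_mul_cexp {x ν : ℝ} (hx : 0 < x) (r : ℂ) :
    ‖((x ^ (ν - 1) : ℝ) : ℂ) * Complex.exp (-(r * x))‖ = x ^ (ν - 1) * Real.exp (-(r.re * x)) := by
  rw [norm_mul, Complex.norm_real, Real.norm_of_nonneg (by positivity), Complex.norm_exp]
  simp

theorem aestronglyMeasurable_rpow_mul_cexp (ν : ℝ) (r : ℂ) (μ : Measure ℝ) :
    AEStronglyMeasurable (fun x : ℝ => ((x ^ (ν - 1) : ℝ) : ℂ) * Complex.exp (-(r * x))) μ := by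
  have : Measurable fun x : ℝ => ((x ^ (ν - 1) : ℝ) : ℂ) * Complex.exp (-(r * x)) := by fun_prop
  exact this.aestronglyMeasurable

theorem integrableOn_rpow_mul_cexp {ν : ℝ} (hν : 0 < ν) {r : ℂ} (hr : 0 < r.re) :
    IntegrableOn (fun x : ℝ => ((x ^ (ν - 1) : ℝ) : ℂ) * Complex.exp (-(r * x))) (Set.Ioi 0) := by
  refine (integrableOn_rpow_mul_exp_neg_mul hν hr).mono'
    (aestronglyMeasurable_rpow_mul_cexp _ _ _) ?_
  filter_upwards [ae_restrict_mem measurableSet_Ioi] with x hx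
  rw [norm_rpow_mul_cexp hx]

theorem differentiableAt_integral_rpow_mul_cexp {ν : ℝ} (hν : 0 < ν) {r : ℂ} (hr : 0 < r.re) :
    DifferentiableAt ℂ (fun r : ℂ => ∫ x in Set.Ioi (0 : ℝ),
      ((x ^ (ν - 1) : ℝ) : ℂ) * Complex.exp (-(r * x))) r := by
  have hs : {z : ℂ | r.re / 2 < z.re} ∈ 𝓝 r :=
    (isOpen_lt continuous_const Complex.continuous_re).mem_nhds (by simp; linarith)
  have key := hasDerivAt_integral_of_dominated_loc_of_deriv_le (𝕜 := ℂ)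
    (μ := volume.restrict (Set.Ioi (0 : ℝ)))
    (F := fun (r : ℂ) (x : ℝ) => ((x ^ (ν - 1) : ℝ) : ℂ) * Complex.exp (-(r * x)))
    (F' := fun (r : ℂ) (x : ℝ) => ((x ^ (ν - 1) : ℝ) : ℂ) * (Complex.exp (-(r * x)) * -x))
    (x₀ := r) (bound := fun x : ℝ => x ^ ((ν + 1) - 1) * Real.exp (-(r.re / 2 * x))) hs
    (Eventually.of_forall fun z => aestronglyMeasurable_rpow_mul_cexp _ _ _)
    (integrableOn_rpow_mul_cexp hν hr) ?_ ?_
    (integrableOn_rpow_mul_exp_neg_mul (by linarith) (by linarith)) ?_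
  · exact key.2.differentiableAt
  · have : Measurable fun x : ℝ =>
        ((x ^ (ν - 1) : ℝ) : ℂ) * (Complex.exp (-(r * x)) * -x) := by fun_prop
    exact this.aestronglyMeasurable
  · filter_upwards [ae_restrict_mem measurableSet_Ioi] with x hx z hz
    have hx' : 0 < x := hx
    rw [← mul_assoc, norm_mul, norm_rpow_mul_cexp hx, norm_neg, Complex.norm_real,
      Real.norm_of_nonneg hx'.le, show ν + 1 - 1 = ν - 1 + 1 by ring, Real.rpow_add_one hx'.ne',
      mul_right_comm]
    have hz' : r.re / 2 < z.re := hz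
    gcongr
  · refine Eventually.of_forall fun x z _ => HasDerivAt.const_mul _ ?_
    have h1 : HasDerivAt (fun z : ℂ => -(z * x)) (-(x : ℂ)) z := by
      exact (((hasDerivAt_id z).mul_const (x : ℂ)).fun_neg).congr_deriv (by simp)
    exact h1.cexp

/-- Euler's integral with complex rate, obtained from the real one by analytic continuation. -/
theorem integral_rpow_mul_cexp {ν : ℝ} (hν : 0 < ν) {r : ℂ} (hr : 0 < r.re) :
    ∫ x in Set.Ioi (0 : ℝ), ((x ^ (ν - 1) : ℝ) : ℂ) * Complex.exp (-(r * x)) =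
      Complex.Gamma ν * r ^ (-ν : ℂ) := by
  set U : Set ℂ := {z | 0 < z.re} with hU
  have hUo : IsOpen U := isOpen_lt continuous_const Complex.continuous_re
  have hf : AnalyticOnNhd ℂ (fun r : ℂ => ∫ x in Set.Ioi (0 : ℝ),
      ((x ^ (ν - 1) : ℝ) : ℂ) * Complex.exp (-(r * x))) U :=
    DifferentiableOn.analyticOnNhd (fun z hz =>
      (differentiableAt_integral_rpow_mul_cexp hν hz).differentiableWithinAt) hUo
  have hg : AnalyticOnNhd ℂ (fun r : ℂ => Complex.Gamma ν * r ^ (-ν : ℂ)) U := by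
    refine DifferentiableOn.analyticOnNhd (fun z hz => DifferentiableAt.differentiableWithinAt ?_) hUo
    exact (differentiableAt_id.cpow_const (Or.inl hz)).const_mul _
  have hpre : IsPreconnected U := (convex_halfSpace_re_gt 0).isPreconnected
  have hreal : ∀ t : ℝ, 0 < t → (∫ x in Set.Ioi (0 : ℝ),
      ((x ^ (ν - 1) : ℝ) : ℂ) * Complex.exp (-((t : ℂ) * x))) =
        Complex.Gamma ν * (t : ℂ) ^ (-ν : ℂ) := by
    intro t ht
    have h := congrArg (fun x : ℝ => (x : ℂ)) (Real.integral_rpow_mul_exp_neg_mul_Ioi hν ht)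
    rw [← integral_complex_ofReal] at h
    push_cast at h ⊢
    rw [h, ← Complex.ofReal_neg, ← Complex.ofReal_cpow ht.le, Real.rpow_neg ht.le,
      Complex.Gamma_ofReal, one_div, Real.inv_rpow ht.le, mul_comm]
  refine hf.eqOn_of_preconnected_of_frequently_eq hg hpre (z₀ := 1) (by simp [hU]) ?_ hr
  have ht : Tendsto (fun n : ℕ => ((1 + 1 / ((n : ℝ) + 1) : ℝ) : ℂ)) atTop (𝓝[≠] 1) := by
    refine tendsto_nhdsWithin_iff.2 ⟨?_, Eventually.of_forall fun n => ?_⟩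
    · have := (tendsto_one_div_add_atTop_nhds_zero_nat (𝕜 := ℝ)).const_add 1
      rw [add_zero] at this
      exact (Complex.continuous_ofReal.tendsto _).comp this
    · have h1 : (1 + 1 / ((n : ℝ) + 1) : ℝ) ≠ 1 := by
        have : 0 < 1 / ((n : ℝ) + 1) := by positivity
        linarith
      exact fun h => h1 (Complex.ofReal_injective (h.trans Complex.ofReal_one.symm))
  refine ht.frequently (Frequently.of_forall fun n => ?_)
  exact hreal _ (by positivity)

theorem hasHalfPlaneDecay_cpow {ν : ℝ} (hν : 1 < ν) (c₀ : ℝ) :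
    HasHalfPlaneDecay (fun s => (s + (1 - c₀ : ℝ)) ^ (-ν : ℂ)) c₀ ν 1 where
  one_lt := hν
  nonneg := zero_le_one
  diff s hs := by
    refine DifferentiableAt.cpow_const (by fun_prop) (Or.inl ?_)
    simp; linarith
  bound s hs := by
    rw [one_mul, ← Complex.ofReal_neg, Complex.norm_cpow_real]

open FourierTransform in
/-- The inverse Laplace transform of a power, by Fourier inversion of the Gamma density. -/
theorem vertInv_cpow {ν : ℝ} (hν : 1 < ν) (c₀ : ℝ) {x : ℝ} (hx : 0 < x) :
    vertInv (fun s => (s + (1 - c₀ : ℝ)) ^ (-ν : ℂ)) c₀ x =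
      ((x ^ (ν - 1) * Real.exp (-((1 - c₀) * x)) / Real.Gamma ν : ℝ) : ℂ) := by
  have hν0 : 0 < ν := by linarith
  -- The Gamma density, extended by zero; it is continuous at `0` because `ν > 1`.
  set g : ℝ → ℂ := fun x => ((max x 0 ^ (ν - 1) : ℝ) : ℂ) * Complex.exp (-((1 : ℝ) * x)) with hg
  have hgc : Continuous g := by
    have : Continuous fun x : ℝ => max x 0 ^ (ν - 1) :=
      Continuous.rpow_const (by fun_prop) fun x => Or.inr (by linarith)
    exact (Complex.continuous_ofReal.comp this).mul (by fun_prop)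
  have hg0 : ∀ x ≤ 0, g x = 0 := fun x hx => by
    simp [hg, max_eq_right hx, Real.zero_rpow (show ν - 1 ≠ 0 by linarith)]
  have hgpos : ∀ x ∈ Set.Ioi (0 : ℝ),
      ((x ^ (ν - 1) : ℝ) : ℂ) * Complex.exp (-(((1 : ℝ) : ℂ) * x)) = g x := fun x hx => by
    simp only [hg]; rw [max_eq_left (le_of_lt hx)]
  have hgi : Integrable g := by
    refine (integrableOn_iff_integrable_of_support_subset (s := Set.Ioi 0) ?_).1
      ((integrableOn_rpow_mul_cexp hν0 (r := ((1 : ℝ) : ℂ)) (by simp)).congr_fun hgpos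
        measurableSet_Ioi)
    intro x hx
    by_contra hx'
    exact hx (hg0 x (not_lt.1 hx'))
  set F : ℂ → ℂ := fun s => (s + (1 - c₀ : ℝ)) ^ (-ν : ℂ) with hF
  have hFg : 𝓕 g = fun y : ℝ => Complex.Gamma ν * F (c₀ + (2 * Real.pi * y : ℝ) * Complex.I) := by
    ext y
    rw [Real.fourier_eq']
    have e1 : ∀ x ∉ Set.Ioi (0 : ℝ),
        Complex.exp (((-2 * Real.pi * inner ℝ x y : ℝ) : ℂ) * Complex.I) • g x = 0 :=
      fun x hx => by rw [hg0 x (not_lt.1 hx), smul_zero]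
    rw [← setIntegral_eq_integral_of_forall_compl_eq_zero e1]
    have e2 : (c₀ + (2 * Real.pi * y : ℝ) * Complex.I + (1 - c₀ : ℝ) : ℂ) =
        1 + (2 * Real.pi * y : ℝ) * Complex.I := by push_cast; ring
    simp only [hF]
    rw [e2, ← integral_rpow_mul_cexp hν0 (by simp)]
    refine setIntegral_congr_fun measurableSet_Ioi fun x hx => ?_
    rw [← hgpos x hx, smul_eq_mul, mul_left_comm, ← Complex.exp_add]
    congr 2
    simp
    ring
  have hdec := hasHalfPlaneDecay_cpow hν c₀
  have hFi : Integrable (𝓕 g) := by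
    rw [hFg]
    refine Integrable.const_mul ?_ _
    exact (hdec.integrable_vertical le_rfl).comp_mul_left' (R := 2 * Real.pi) (by positivity)
  have hinv := congrFun (hgc.fourierInv_fourier_eq hgi hFi) x
  have hG : Complex.Gamma ν ≠ 0 := by
    rw [Complex.Gamma_ofReal]; exact_mod_cast (Real.Gamma_pos_of_pos hν0).ne'
  have hlin : 𝓕⁻ (fun y : ℝ => Complex.Gamma ν * F (c₀ + (2 * Real.pi * y : ℝ) * Complex.I)) x =
      Complex.Gamma ν * 𝓕⁻ (fun y : ℝ => F (c₀ + (2 * Real.pi * y : ℝ) * Complex.I)) x := by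
    rw [Real.fourierInv_eq', Real.fourierInv_eq', ← integral_const_mul]
    refine integral_congr_ae (Eventually.of_forall fun y => ?_)
    simp only [smul_eq_mul]; ring
  rw [hFg, hlin, fourierInv_comp_vertical, ← hgpos x hx] at hinv
  have hexp : Complex.exp (-(c₀ * x)) ≠ 0 := Complex.exp_ne_zero _
  have hv : vertInv F c₀ x = ((x ^ (ν - 1) : ℝ) : ℂ) * Complex.exp (-(((1 : ℝ) : ℂ) * x)) *
      (Complex.Gamma ν)⁻¹ * (Complex.exp (-(c₀ * x)))⁻¹ := by
    rw [← hinv]; field_simp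
  rw [hv, ← Complex.exp_neg, Complex.Gamma_ofReal]
  have e3 : Complex.exp (-(((1 : ℝ) : ℂ) * x)) * Complex.exp (-(-(c₀ * x))) =
      ((Real.exp (-((1 - c₀) * x)) : ℝ) : ℂ) := by
    rw [← Complex.exp_add]; push_cast; congr 1; ring
  rw [Complex.ofReal_div, Complex.ofReal_mul, ← e3]
  ring

/-- For exponents `0 < μ ≤ 1` the inverse Laplace integral of a power converges only conditionally;
one integration by parts reduces it to the exponent `μ + 1`. -/
theorem tendsto_integral_exp_mul_cpow {μ : ℝ} (hμ : 0 < μ) {c₀ c : ℝ} (hc : c₀ ≤ c) {x : ℝ}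
    (hx : 0 < x) :
    Tendsto (fun T : ℝ => (2 * Real.pi : ℂ)⁻¹ * ∫ y in (-T)..T,
      Complex.exp (x * (c + y * Complex.I)) * (c + y * Complex.I + (1 - c₀ : ℝ)) ^ (-μ : ℂ)) atTop
      (𝓝 ((x ^ (μ - 1) * Real.exp (-((1 - c₀) * x)) / Real.Gamma μ : ℝ) : ℂ)) := by
  have hre : ∀ y : ℝ, 0 < (c + y * Complex.I + (1 - c₀ : ℝ) : ℂ).re := fun y => by
    simp; linarith
  have hmem : ∀ y : ℝ, (c + y * Complex.I + (1 - c₀ : ℝ) : ℂ) ∈ Complex.slitPlane :=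
    fun y => Or.inl (hre y)
  set f : ℝ → ℂ := fun y =>
    Complex.exp (x * (c + y * Complex.I)) * (c + y * Complex.I + (1 - c₀ : ℝ)) ^ (-μ : ℂ) with hf
  set g : ℝ → ℂ := fun y => Complex.exp (x * (c + y * Complex.I)) *
    (c + y * Complex.I + (1 - c₀ : ℝ)) ^ (-(μ + 1 : ℝ) : ℂ) with hg
  have hdec := hasHalfPlaneDecay_cpow (show 1 < μ + 1 by linarith) c₀
  have hgi : Integrable g := hdec.integrable_exp_mul_vertical hc x
  have hfd : ∀ y : ℝ, HasDerivAt f (Complex.I * x * f y - Complex.I * μ * g y) y := by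
    intro y
    have h1 : HasDerivAt (fun s : ℂ => (c + s * Complex.I : ℂ)) Complex.I (y : ℂ) := by
      simpa using ((hasDerivAt_id (y : ℂ)).mul_const Complex.I).const_add (c : ℂ)
    have h2 := (h1.const_mul (x : ℂ)).cexp
    have h3 := (h1.add_const (((1 - c₀ : ℝ) : ℂ))).cpow_const (c := (-μ : ℂ)) (hmem y)
    refine (h2.fun_mul h3).comp_ofReal.congr_deriv ?_
    simp only [hf, hg]
    have : (-(μ : ℂ) - 1) = (-((μ + 1 : ℝ)) : ℂ) := by push_cast; ring
    rw [this]
    ring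
  have hfc : Continuous f := continuous_iff_continuousAt.2 fun y => (hfd y).continuousAt
  have hgc : Continuous g := by
    have := hdec.continuous_vertical hc
    exact Continuous.mul (by fun_prop) this
  have hbound : ∀ y : ℝ, ‖f y‖ ≤ Real.exp (c * x) * (1 + ‖y‖ ^ 2) ^ (-μ / 2) := by
    intro y
    rw [hf]
    simp only
    rw [norm_mul, Complex.norm_exp, ← Complex.ofReal_neg, Complex.norm_cpow_real]
    have e : ((x : ℂ) * (c + y * Complex.I)).re = c * x := by simp [mul_comm]
    rw [e]
    refine mul_le_mul_of_nonneg_left ?_ (Real.exp_nonneg _)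
    have := norm_rpow_neg_vertical_le (c := c + (1 - c₀)) (by linarith) hμ.le y
    have e2 : (c + y * Complex.I + (1 - c₀ : ℝ) : ℂ) = (c + (1 - c₀) : ℝ) + y * Complex.I := by
      push_cast; ring
    rw [e2]
    exact this
  have hw : Tendsto (fun T : ℝ => Real.exp (c * x) * (1 + ‖T‖ ^ 2) ^ (-μ / 2)) atTop (𝓝 0) := by
    have h1 : Tendsto (fun T : ℝ => 1 + ‖T‖ ^ 2) atTop atTop :=
      tendsto_atTop_add_const_left _ _
        ((tendsto_pow_atTop two_ne_zero).comp tendsto_norm_atTop_atTop)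
    have h2 := (tendsto_rpow_neg_atTop (show 0 < μ / 2 by linarith)).comp h1
    have h3 := h2.const_mul (Real.exp (c * x))
    rw [mul_zero] at h3
    refine h3.congr fun T => ?_
    simp only [Function.comp]; congr 2; ring
  have hf1 : Tendsto (fun T : ℝ => f T) atTop (𝓝 0) := squeeze_zero_norm hbound hw
  have hf2 : Tendsto (fun T : ℝ => f (-T)) atTop (𝓝 0) :=
    squeeze_zero_norm (fun T => by simpa using hbound (-T)) hw
  have hx0 : (x : ℂ) ≠ 0 := by exact_mod_cast hx.ne'
  have hparts : ∀ T : ℝ, ∫ y in (-T)..T, f y =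
      (Complex.I * x)⁻¹ * (f T - f (-T)) + μ / x * ∫ y in (-T)..T, g y := by
    intro T
    have h1 := intervalIntegral.integral_eq_sub_of_hasDerivAt (a := -T) (b := T)
      (fun y _ => hfd y) (Continuous.intervalIntegrable (by fun_prop) _ _)
    rw [intervalIntegral.integral_sub (Continuous.intervalIntegrable (by fun_prop) _ _)
      (Continuous.intervalIntegrable (by fun_prop) _ _), intervalIntegral.integral_const_mul,
      intervalIntegral.integral_const_mul] at h1
    have hI := Complex.I_ne_zero
    rw [← h1]
    field_simp
    ring
  have hlim := (((hf1.sub hf2).const_mul (Complex.I * x)⁻¹).add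
    ((intervalIntegral_tendsto_integral hgi tendsto_neg_atTop_atBot tendsto_id).const_mul
      (μ / x : ℂ))).const_mul (2 * Real.pi : ℂ)⁻¹
  have hval := vertInv_cpow (show 1 < μ + 1 by linarith) c₀ hx
  rw [← hdec.vertInv_eq hc, vertInv] at hval
  have hlimval : (2 * Real.pi : ℂ)⁻¹ * ((Complex.I * x)⁻¹ * (0 - 0) + μ / x * ∫ y, g y) =
      ((x ^ (μ - 1) * Real.exp (-((1 - c₀) * x)) / Real.Gamma μ : ℝ) : ℂ) := by
    rw [sub_zero, mul_zero, zero_add, mul_left_comm]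
    simp only [hg]
    rw [hval, add_sub_cancel_right, Real.Gamma_add_one hμ.ne', Real.rpow_sub_one hx.ne']
    have hG : (Real.Gamma μ : ℂ) ≠ 0 := by exact_mod_cast (Real.Gamma_pos_of_pos hμ).ne'
    have hμ0 : (μ : ℂ) ≠ 0 := by exact_mod_cast hμ.ne'
    push_cast
    field_simp
  rw [hlimval] at hlim
  exact hlim.congr fun T => by rw [hparts T]; rfl

/-! ### The `H`-function and its moments -/

section HFunction

variable {p q : ℕ} {a A : Fin p → ℝ} {b B : Fin q → ℝ}

/-- In the variable `x = log (ρ / ξ)` the function `H` is the sum of an explicit Gamma density, which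
carries the singularity at `ξ = ρ`, and an absolutely convergent inverse Laplace integral. Its
Laplace transform at `n` is the kernel at `n`, up to the scaling by `ρ`. -/
theorem exists_laplace_density (hA : ∀ j, 0 < A j) (hB : ∀ j, 0 < B j)
    (hAB : ∑ j, A j = ∑ j, B j) (hμ : 0 < foxMu a b) (hγ : 0 < foxGamma a A)
    {c : ℝ} (hc : -foxGamma a A < c) :
    ∃ h : ℝ → ℂ,
      (∀ ξ ∈ Set.Ioo 0 (foxRho A B), Tendsto (foxHTruncated a A b B c (ξ : ℂ)) atTop
        (𝓝 (h (Real.log (foxRho A B) - Real.log ξ)))) ∧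
      ∀ n : ℕ, IntegrableOn (fun x : ℝ => Complex.exp (-(n * x)) * h x) (Set.Ioi 0) ∧
        ∫ x in Set.Ioi (0 : ℝ), Complex.exp (-(n * x)) * h x =
          foxKernel a A b B n * Complex.exp (-n * Real.log (foxRho A B)) := by
  -- A line that lies to the left of both `Re s = c` and `Re s = 0`, but to the right of the poles.
  obtain ⟨c₀, hc₀, hlt⟩ := exists_between (show -foxGamma a A < min c 0 from lt_min hc (by linarith))
  have hc₀c : c₀ ≤ c := (hlt.trans_le (min_le_left _ _)).le
  have hc₀0 : c₀ < 0 := hlt.trans_le (min_le_right _ _)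
  obtain ⟨C, M, hM, hbound⟩ := exists_foxKernel_sub_le hA hB hAB hμ hc₀
  set μ := foxMu a b
  set ρ := foxRho A B
  have hρ : 0 < ρ := foxRho_pos hA hB
  set R : ℂ → ℂ := fun s => foxKernel a A b B s * Complex.exp (-s * Real.log ρ) -
    C * (s + (1 - c₀ : ℝ)) ^ (-μ : ℂ) with hR
  have hdec : HasHalfPlaneDecay R c₀ (μ + 1) M := by
    refine ⟨by linarith, hM, fun s hs => ?_, hbound⟩
    refine ((differentiableAt_foxKernel hA (by linarith)).mul (by fun_prop)).sub
      (DifferentiableAt.const_mul (DifferentiableAt.cpow_const (by fun_prop) (Or.inl ?_)) C)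
    simp; linarith
  refine ⟨fun x => C * ((x ^ (μ - 1) * Real.exp (-((1 - c₀) * x)) / Real.Gamma μ : ℝ) : ℂ) +
    vertInv R c₀ x, fun ξ hξ => ?_, fun n => ?_⟩
  · have hx : 0 < Real.log ρ - Real.log ξ := sub_pos.2 (Real.log_lt_log hξ.1 hξ.2)
    set x := Real.log ρ - Real.log ξ with hxdef
    have hRi := hdec.integrable_exp_mul_vertical hc₀c x
    have h1 := (tendsto_integral_exp_mul_cpow hμ hc₀c hx).const_mul C
    have h2 := (intervalIntegral_tendsto_integral hRi tendsto_neg_atTop_atBot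
      tendsto_id).const_mul (2 * Real.pi : ℂ)⁻¹
    have h3 : (2 * Real.pi : ℂ)⁻¹ * ∫ y : ℝ, Complex.exp (x * (c + y * Complex.I)) *
        R (c + y * Complex.I) = vertInv R c₀ x := by
      rw [← hdec.vertInv_eq hc₀c]; rfl
    rw [h3] at h2
    refine (h1.add h2).congr fun T => ?_
    have hξ0 : (ξ : ℂ) ≠ 0 := by exact_mod_cast hξ.1.ne'
    have e : ∀ y : ℝ, foxKernel a A b B (c + y * Complex.I) *
        (ξ : ℂ) ^ (-(c + y * Complex.I) : ℂ) * Complex.I =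
        Complex.I * (C * (Complex.exp (x * (c + y * Complex.I)) *
          (c + y * Complex.I + (1 - c₀ : ℝ)) ^ (-μ : ℂ)) +
          Complex.exp (x * (c + y * Complex.I)) * R (c + y * Complex.I)) := by
      intro y
      have e1 : (ξ : ℂ) ^ (-(c + y * Complex.I) : ℂ) = Complex.exp (x * (c + y * Complex.I)) *
          Complex.exp (-(c + y * Complex.I) * Real.log ρ) := by
        rw [Complex.cpow_def_of_ne_zero hξ0, ← Complex.exp_add, ← Complex.ofReal_log hξ.1.le, hxdef]
        push_cast
        congr 1; ring
      rw [e1, hR]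
      ring
    have hcont : Continuous fun y : ℝ => C * (Complex.exp (x * (c + y * Complex.I)) *
        (c + y * Complex.I + (1 - c₀ : ℝ)) ^ (-μ : ℂ)) := by
      refine continuous_const.mul (Continuous.mul (by fun_prop) ?_)
      refine Continuous.cpow (by fun_prop) continuous_const fun y => Or.inl ?_
      simp; linarith
    rw [foxHTruncated]
    simp only [e]
    rw [intervalIntegral.integral_const_mul, intervalIntegral.integral_add
      (hcont.intervalIntegrable _ _) hRi.intervalIntegrable, intervalIntegral.integral_const_mul]
    have hI := Complex.I_ne_zero
    rw [mul_inv (2 * Real.pi : ℂ) Complex.I, mul_assoc _ Complex.I⁻¹, inv_mul_cancel_left₀ hI]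
    simp only [id]
    ring
  · have hn : (0 : ℝ) ≤ n := Nat.cast_nonneg n
    obtain ⟨hi2, hv2⟩ := hdec.laplace_vertInv (σ := n) (by linarith)
    have hr : 0 < (((n + (1 - c₀) : ℝ)) : ℂ).re := by
      rw [Complex.ofReal_re]; linarith
    have hi1 := ((integrableOn_rpow_mul_cexp hμ hr).const_mul (C / Real.Gamma μ))
    have hv1 := integral_rpow_mul_cexp hμ hr
    have hG : (Real.Gamma μ : ℂ) ≠ 0 := by exact_mod_cast (Real.Gamma_pos_of_pos hμ).ne'
    have e : ∀ x : ℝ, Complex.exp (-(n * x)) *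
        (C * ((x ^ (μ - 1) * Real.exp (-((1 - c₀) * x)) / Real.Gamma μ : ℝ) : ℂ) +
          vertInv R c₀ x) = C / Real.Gamma μ * (((x ^ (μ - 1) : ℝ) : ℂ) *
          Complex.exp (-(((n + (1 - c₀) : ℝ) : ℂ) * x))) +
          Complex.exp (-(((n : ℝ) : ℂ) * x)) * vertInv R c₀ x := by
      intro x
      have : Complex.exp (-(((n + (1 - c₀) : ℝ) : ℂ) * x)) =
          Complex.exp (-(n * x)) * Complex.exp (-((1 - c₀) * x)) := by
        rw [← Complex.exp_add]; push_cast; congr 1; ring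
      rw [this]
      push_cast
      ring
    simp only [e]
    refine ⟨hi1.add hi2, ?_⟩
    rw [integral_add hi1 hi2, hv2, integral_const_mul, hv1, Complex.Gamma_ofReal, hR]
    push_cast
    field_simp
    ring

/-- The moments of `H(ξ) dξ / ξ` on `(0, ρ)` are the values of the kernel at the natural numbers. -/
theorem foxH_moments (hA : ∀ j, 0 < A j) (hB : ∀ j, 0 < B j)
    (hAB : ∑ j, A j = ∑ j, B j) (hμ : 0 < foxMu a b) (hγ : 0 < foxGamma a A)
    {c : ℝ} (hc : -foxGamma a A < c) :
    (∀ ξ ∈ Set.Ioo 0 (foxRho A B), Tendsto (foxHTruncated a A b B c (ξ : ℂ)) atTop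
      (𝓝 (foxH a A b B c (ξ : ℂ)))) ∧
    ∀ n : ℕ, IntegrableOn (fun ξ : ℝ => (ξ : ℂ) ^ n * ((ξ : ℂ)⁻¹ * foxH a A b B c (ξ : ℂ)))
        (Set.Ioo 0 (foxRho A B)) ∧
      ∫ ξ in Set.Ioo 0 (foxRho A B), (ξ : ℂ) ^ n * ((ξ : ℂ)⁻¹ * foxH a A b B c (ξ : ℂ)) =
        foxKernel a A b B n := by
  obtain ⟨h, hT, hL⟩ := exists_laplace_density hA hB hAB hμ hγ hc
  have hH : ∀ ξ ∈ Set.Ioo 0 (foxRho A B), foxH a A b B c (ξ : ℂ) =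
      h (Real.log (foxRho A B) - Real.log ξ) := fun ξ hξ => (hT ξ hξ).limUnder_eq
  refine ⟨fun ξ hξ => by rw [hH ξ hξ]; exact hT ξ hξ, fun n => ?_⟩
  set ρ := foxRho A B
  have hρ : 0 < ρ := foxRho_pos hA hB
  have himg : (fun x : ℝ => ρ * Real.exp (-x)) '' Set.Ioi 0 = Set.Ioo 0 ρ := by
    ext ξ
    constructor
    · rintro ⟨x, hx, rfl⟩
      have hx' : Real.exp (-x) < 1 :=
        Real.exp_zero ▸ Real.exp_lt_exp.2 (neg_lt_zero.2 hx)
      exact ⟨by positivity, by nlinarith⟩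
    · rintro ⟨h0, h1⟩
      refine ⟨Real.log ρ - Real.log ξ, sub_pos.2 (Real.log_lt_log h0 h1), ?_⟩
      simp only [neg_sub, Real.exp_sub, Real.exp_log h0, Real.exp_log hρ]
      field_simp
  have hinj : Set.InjOn (fun x : ℝ => ρ * Real.exp (-x)) (Set.Ioi 0) := by
    intro x _ y _ hxy
    have := mul_left_cancel₀ hρ.ne' hxy
    exact neg_injective (Real.exp_injective this)
  have hder : ∀ x ∈ Set.Ioi (0 : ℝ), HasDerivWithinAt (fun x : ℝ => ρ * Real.exp (-x))
      (-(ρ * Real.exp (-x))) (Set.Ioi 0) x := fun x _ => by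
    have := ((hasDerivAt_neg x).exp.const_mul ρ).hasDerivWithinAt (s := Set.Ioi 0)
    simpa using this
  have hcongr : ∀ x ∈ Set.Ioi (0 : ℝ), |-(ρ * Real.exp (-x))| •
      (((ρ * Real.exp (-x) : ℝ) : ℂ) ^ n * (((ρ * Real.exp (-x) : ℝ) : ℂ)⁻¹ *
        foxH a A b B c ((ρ * Real.exp (-x) : ℝ) : ℂ))) =
      (ρ : ℂ) ^ n * (Complex.exp (-(n * x)) * h x) := by
    intro x hx
    have hmem : ρ * Real.exp (-x) ∈ Set.Ioo 0 ρ := himg ▸ ⟨x, hx, rfl⟩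
    have hpos : 0 < ρ * Real.exp (-x) := hmem.1
    have hlog : Real.log ρ - Real.log (ρ * Real.exp (-x)) = x := by
      rw [Real.log_mul hρ.ne' (Real.exp_pos _).ne', Real.log_exp]; ring
    rw [hH _ hmem, hlog, abs_neg, abs_of_pos hpos, Complex.real_smul, mul_left_comm,
      mul_inv_cancel_left₀ (by exact_mod_cast hpos.ne')]
    push_cast
    rw [mul_pow, ← Complex.exp_nat_mul, mul_neg, mul_assoc]
  have hLn := hL n
  constructor
  · rw [← himg, integrableOn_image_iff_integrableOn_abs_deriv_smul measurableSet_Ioi hder hinj]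
    have hi : IntegrableOn (fun x : ℝ => (ρ : ℂ) ^ n * (Complex.exp (-(n * x)) * h x))
      (Set.Ioi 0) := hLn.1.const_mul _
    exact hi.congr_fun (fun x hx => (hcongr x hx).symm) measurableSet_Ioi
  · rw [← himg, integral_image_eq_integral_abs_deriv_smul measurableSet_Ioi hder hinj,
      setIntegral_congr_fun measurableSet_Ioi hcongr, integral_const_mul, hLn.2]
    have : Complex.exp (-(n : ℂ) * Real.log ρ) = ((ρ : ℂ) ^ n)⁻¹ := by
      rw [neg_mul, Complex.exp_neg, Complex.exp_nat_mul, ← Complex.ofReal_exp, Real.exp_log hρ]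
    have hρ0 : (ρ : ℂ) ^ n ≠ 0 := pow_ne_zero _ (by exact_mod_cast hρ.ne')
    rw [this]
    field_simp

end HFunction

/-! ### Summation under the integral sign -/

/-- The quotient of Gamma values agrees with the binomial coefficient of Mathlib's binomial series. -/
theorem genBinom_eq_choose {lam : ℝ} (hlam : 0 < lam) (k : ℕ) :
    genBinom (lam + k - 1) k = Ring.choose (lam + k - 1) k := by
  have hG : ∀ k : ℕ, Real.Gamma (lam + k) = (ascPochhammer ℝ k).eval lam * Real.Gamma lam := by
    intro k
    induction k with
    | zero => simp
    | succ k ih =>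
      have h : lam + (k : ℝ) ≠ 0 := by positivity
      rw [Nat.cast_succ, ← add_assoc, Real.Gamma_add_one h, ih, ascPochhammer_succ_eval]
      ring
  have h1 : (k.factorial : ℝ) * Ring.choose (lam + k - 1) k = (ascPochhammer ℝ k).eval lam := by
    rw [← nsmul_eq_mul, ← Ring.descPochhammer_eq_factorial_smul_choose,
      Polynomial.descPochhammer_smeval_eq_ascPochhammer, Polynomial.ascPochhammer_smeval_eq_eval]
    congr 1; ring
  have hΓ := (Real.Gamma_pos_of_pos hlam).ne'
  have hk : (k.factorial : ℝ) ≠ 0 := by positivity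
  rw [genBinom, Real.Gamma_nat_eq_factorial, show lam + k - 1 + 1 = lam + k by ring,
    show lam + k - 1 - k + 1 = lam by ring, hG, ← h1]
  field_simp

theorem hasSum_genBinom_mul_pow {lam : ℝ} (hlam : 0 < lam) {x : ℝ} (hx : |x| < 1) :
    HasSum (fun k : ℕ => genBinom (lam + k - 1) k * x ^ k) ((1 - x) ^ (-lam)) := by
  have h := (Real.one_div_one_sub_rpow_hasFPowerSeriesOnBall_zero lam).hasSum (y := x) (by
    rw [← ENNReal.ofReal_one, Metric.eball_ofReal]; simpa using hx)
  simp only [zero_add] at h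
  rw [Real.rpow_neg (by linarith [(abs_lt.1 hx).2]), ← one_div]
  simpa [FormalMultilinearSeries.ofScalars_apply_eq, genBinom_eq_choose hlam, mul_comm] using h

theorem genBinom_nonneg {lam : ℝ} (hlam : 0 < lam) (k : ℕ) : 0 ≤ genBinom (lam + k - 1) k := by
  have h1 : 0 < lam + k - 1 + 1 := by
    have : (0 : ℝ) ≤ k := k.cast_nonneg
    linarith
  have h2 : 0 < lam + k - 1 - k + 1 := by linarith
  have h3 : (0 : ℝ) < k + 1 := by positivity
  exact div_nonneg (Real.Gamma_pos_of_pos h1).le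
    (mul_nonneg (Real.Gamma_pos_of_pos h3).le (Real.Gamma_pos_of_pos h2).le)

/-- Termwise integration of a uniformly summable series of real weights against an integrable
function. -/
theorem hasSum_setIntegral_mul {G : ℝ → ℂ} {s : Set ℝ} (hs : MeasurableSet s)
    (hG : IntegrableOn G s) {φ : ℕ → ℝ → ℝ} {Φ : ℝ → ℝ} {u : ℕ → ℝ}
    (hφ : ∀ n, Measurable (φ n)) (hΦ : Measurable Φ) (hu : Summable u)
    (hb : ∀ n, ∀ ξ ∈ s, |φ n ξ| ≤ u n) (hsum : ∀ ξ ∈ s, HasSum (fun n => φ n ξ) (Φ ξ)) :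
    IntegrableOn (fun ξ => (Φ ξ : ℂ) * G ξ) s ∧
      HasSum (fun n => ∫ ξ in s, (φ n ξ : ℂ) * G ξ) (∫ ξ in s, (Φ ξ : ℂ) * G ξ) := by
  constructor
  · refine Integrable.bdd_mul (c := ∑' n, u n) hG
      (Complex.measurable_ofReal.comp hΦ).aestronglyMeasurable ?_
    filter_upwards [ae_restrict_mem hs] with ξ hξ
    rw [Complex.norm_real, ← (hsum ξ hξ).tsum_eq]
    exact tsum_of_norm_bounded hu.hasSum (fun n => hb n ξ hξ)
  · refine hasSum_integral_of_dominated_convergence (fun n ξ => u n * ‖G ξ‖) (fun n => ?_)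
      (fun n => ?_) ?_ ?_ ?_
    · exact (Complex.measurable_ofReal.comp (hφ n)).aestronglyMeasurable.mul hG.1
    · filter_upwards [ae_restrict_mem hs] with ξ hξ
      rw [norm_mul, Complex.norm_real]
      exact mul_le_mul_of_nonneg_right (hb n ξ hξ) (norm_nonneg _)
    · exact Eventually.of_forall fun ξ => hu.mul_right _
    · simp only [tsum_mul_right]
      exact hG.norm.const_mul _
    · filter_upwards [ae_restrict_mem hs] with ξ hξ
      exact (Complex.hasSum_ofReal.2 (hsum ξ hξ)).mul_right _

section FoxWright

variable {p q : ℕ} {a A : Fin p → ℝ} {b B : Fin q → ℝ}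

theorem foxKernel_natCast (n : ℕ) :
    foxKernel a A b B n = (((∏ l, Real.Gamma (a l + n * A l)) /
      ∏ l, Real.Gamma (b l + n * B l) : ℝ) : ℂ) := by
  rw [foxKernel]
  push_cast [← Complex.Gamma_ofReal]
  congr 1 <;> exact Finset.prod_congr rfl fun l _ => by congr 1; ring

/-- Shifting the parameters by `k` steps shifts the argument of the kernel by `k`. -/
theorem ofReal_foxWrightTerm_shift (z : ℝ) (k n : ℕ) :
    (foxWrightTerm (fun l => a l + k * A l) A (fun l => b l + k * B l) B z n : ℂ) =
      z ^ n / n.factorial * foxKernel a A b B ((k + n : ℕ) : ℂ) := by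
  rw [foxKernel_natCast, foxWrightTerm, mul_comm]
  have e : ∀ (a A : ℝ), a + k * A + n * A = a + ((k + n : ℕ) : ℝ) * A := fun a A => by
    push_cast; ring
  simp only [e]
  push_cast
  rfl

theorem foxWrightTerm_cons_one {lam : ℝ} (hlam : 0 < lam) (t : ℝ) (k : ℕ) :
    (foxWrightTerm (Fin.cons lam a : Fin (p + 1) → ℝ) (Fin.cons 1 A) b B t k : ℂ) =
      Real.Gamma lam * (genBinom (lam + k - 1) k * t ^ k * foxKernel a A b B k) := by
  rw [foxKernel_natCast, foxWrightTerm, Fin.prod_univ_succ, genBinom,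
    Real.Gamma_nat_eq_factorial, show lam + k - 1 + 1 = lam + k by ring,
    show lam + k - 1 - k + 1 = lam by ring]
  simp only [Fin.cons_zero, Fin.cons_succ, mul_one]
  have hΓ : (Real.Gamma lam : ℂ) ≠ 0 := by exact_mod_cast (Real.Gamma_pos_of_pos hlam).ne'
  push_cast
  field_simp

variable {ρ : ℝ} {G : ℝ → ℂ}

theorem hasSum_foxWrightTerm (hG : IntegrableOn G (Set.Ioo 0 ρ))
    (hmom : ∀ n : ℕ, ∫ ξ in Set.Ioo 0 ρ, (ξ : ℂ) ^ n * G ξ = foxKernel a A b B n)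
    (z : ℝ) (k : ℕ) :
    Summable (foxWrightTerm (fun l => a l + k * A l) A (fun l => b l + k * B l) B z) ∧
      (foxWright (fun l => a l + k * A l) A (fun l => b l + k * B l) B z : ℂ) =
        ∫ ξ in Set.Ioo 0 ρ, ((ξ ^ k * Real.exp (z * ξ) : ℝ) : ℂ) * G ξ := by
  have h := (hasSum_setIntegral_mul measurableSet_Ioo hG
    (φ := fun n ξ => ξ ^ k * ((z * ξ) ^ n / n.factorial))
    (Φ := fun ξ => ξ ^ k * Real.exp (z * ξ))
    (u := fun n => |ρ| ^ k * ((|z| * |ρ|) ^ n / n.factorial)) (fun n => by fun_prop) (by fun_prop)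
    ((Real.summable_pow_div_factorial _).mul_left _) (fun n ξ hξ => ?_) (fun ξ _ => ?_)).2
  · have e : ∀ n : ℕ, ∫ ξ in Set.Ioo 0 ρ,
        ((ξ ^ k * ((z * ξ) ^ n / n.factorial) : ℝ) : ℂ) * G ξ =
        (foxWrightTerm (fun l => a l + k * A l) A (fun l => b l + k * B l) B z n : ℂ) := by
      intro n
      rw [ofReal_foxWrightTerm_shift, ← hmom, ← integral_const_mul]
      refine integral_congr_ae (Eventually.of_forall fun ξ => ?_)
      simp only
      push_cast
      rw [pow_add, mul_pow]
      ring
    simp only [e] at h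
    refine ⟨Complex.summable_ofReal.1 h.summable, ?_⟩
    rw [foxWright, Complex.ofReal_tsum, h.tsum_eq]
  · have hξρ : |ξ| ≤ |ρ| := by
      rw [abs_of_pos hξ.1, abs_of_pos (hξ.1.trans hξ.2)]; exact hξ.2.le
    rw [abs_mul, abs_pow, abs_div, abs_pow, abs_mul, Nat.abs_cast]
    gcongr
  · have := NormedSpace.expSeries_div_hasSum_exp (𝔸 := ℝ) (z * ξ)
    rw [← Real.exp_eq_exp_ℝ] at this
    exact this.mul_left _

theorem hasSum_genBinom_integral (hG : IntegrableOn G (Set.Ioo 0 ρ)) {lam : ℝ} (hlam : 0 < lam)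
    {t : ℝ} (ht : ρ * |t| < 1) (z : ℝ) :
    IntegrableOn (fun ξ => (((1 - t * ξ) ^ (-lam) * Real.exp (z * ξ) : ℝ) : ℂ) * G ξ)
        (Set.Ioo 0 ρ) ∧
      HasSum (fun k : ℕ => ((genBinom (lam + k - 1) k * t ^ k : ℝ) : ℂ) *
          ∫ ξ in Set.Ioo 0 ρ, ((ξ ^ k * Real.exp (z * ξ) : ℝ) : ℂ) * G ξ)
        (∫ ξ in Set.Ioo 0 ρ, (((1 - t * ξ) ^ (-lam) * Real.exp (z * ξ) : ℝ) : ℂ) * G ξ) := by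
  rcases le_or_gt ρ 0 with hρ | hρ
  · simp [Set.Ioo_eq_empty_of_le hρ]
  have hx : |t * ρ| < 1 := by rwa [abs_mul, abs_of_pos hρ, mul_comm]
  have hx' : |(|t| * ρ)| < 1 := by rwa [abs_mul, abs_abs, ← abs_mul]
  have h := hasSum_setIntegral_mul measurableSet_Ioo hG
    (φ := fun k ξ => genBinom (lam + k - 1) k * (t * ξ) ^ k * Real.exp (z * ξ))
    (Φ := fun ξ => (1 - t * ξ) ^ (-lam) * Real.exp (z * ξ))
    (u := fun k => genBinom (lam + k - 1) k * (|t| * ρ) ^ k * Real.exp (|z| * ρ))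
    (fun n => by fun_prop) (by fun_prop)
    ((hasSum_genBinom_mul_pow hlam hx').summable.mul_right _) (fun n ξ hξ => ?_) (fun ξ hξ => ?_)
  · refine ⟨h.1, ?_⟩
    convert h.2 using 2 with k
    rw [← integral_const_mul]
    refine integral_congr_ae (Eventually.of_forall fun ξ => ?_)
    simp only
    push_cast
    rw [mul_pow]
    ring
  · rw [abs_mul, abs_mul, abs_pow, abs_mul, abs_of_nonneg (genBinom_nonneg hlam n),
      abs_of_pos hξ.1, Real.abs_exp]
    have h1 := genBinom_nonneg hlam n
    have h2 : ξ ≤ ρ := hξ.2.le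
    have h3 : 0 ≤ ξ := hξ.1.le
    have h4 : z * ξ ≤ |z| * ρ := by
      calc z * ξ ≤ |z| * ξ := by gcongr; exact le_abs_self z
        _ ≤ |z| * ρ := by gcongr
    gcongr
  · refine (hasSum_genBinom_mul_pow hlam ?_).mul_right _
    refine lt_of_le_of_lt ?_ hx
    rw [abs_mul, abs_mul, abs_of_pos hξ.1, abs_of_pos hρ]
    exact mul_le_mul_of_nonneg_left hξ.2.le (abs_nonneg t)

/-- If `G dξ` has the moments of the kernel, integrating `G` against the generating function
`(1 - t ξ) ^ (-λ) exp (z ξ)` sums the generating series of the Fox-Wright functions. -/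
theorem hasSum_genTerm (hG : IntegrableOn G (Set.Ioo 0 ρ))
    (hmom : ∀ n : ℕ, ∫ ξ in Set.Ioo 0 ρ, (ξ : ℂ) ^ n * G ξ = foxKernel a A b B n)
    {lam : ℝ} (hlam : 0 < lam) {t : ℝ} (ht : ρ * |t| < 1) (z : ℝ) :
    HasSum (fun k : ℕ => (genTerm a A b B lam z t k : ℂ))
      (∫ ξ in Set.Ioo 0 ρ, (((1 - t * ξ) ^ (-lam) * Real.exp (z * ξ) : ℝ) : ℂ) * G ξ) := by
  convert (hasSum_genBinom_integral hG hlam ht z).2 using 2 with k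
  rw [genTerm, ← (hasSum_foxWrightTerm hG hmom z k).2]
  push_cast
  ring

/-- The case `z = 0` of the generating series is the Fox-Wright function with the additional
parameter `(λ, 1)`. -/
theorem hasSum_foxWrightTerm_cons_one (hG : IntegrableOn G (Set.Ioo 0 ρ))
    (hmom : ∀ n : ℕ, ∫ ξ in Set.Ioo 0 ρ, (ξ : ℂ) ^ n * G ξ = foxKernel a A b B n)
    {lam : ℝ} (hlam : 0 < lam) {t : ℝ} (ht : ρ * |t| < 1) :
    HasSum (fun k : ℕ =>
        (foxWrightTerm (Fin.cons lam a : Fin (p + 1) → ℝ) (Fin.cons 1 A) b B t k : ℂ))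
      (Real.Gamma lam * ∫ ξ in Set.Ioo 0 ρ, (((1 - t * ξ) ^ (-lam) : ℝ) : ℂ) * G ξ) := by
  have h := (hasSum_genBinom_integral hG hlam ht 0).2.mul_left (Real.Gamma lam : ℂ)
  simp only [zero_mul, Real.exp_zero, mul_one, Complex.ofReal_pow, hmom] at h
  have e : ∀ k : ℕ,
      (foxWrightTerm (Fin.cons lam a : Fin (p + 1) → ℝ) (Fin.cons 1 A) b B t k : ℂ) =
      Real.Gamma lam * (((genBinom (lam + k - 1) k * t ^ k : ℝ) : ℂ) * foxKernel a A b B k) :=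
    fun k => by rw [foxWrightTerm_cons_one hlam]; push_cast; rfl
  simpa only [e] using h

/-- Where `Re G ≥ 0`, the bounds `1 ≤ exp (z ξ) ≤ exp (ρ z)` pass to the integrals. -/
theorem re_integral_exp_bounds (hG : IntegrableOn G (Set.Ioo 0 ρ))
    (hpos : ∀ ξ ∈ Set.Ioo 0 ρ, 0 ≤ (G ξ).re) {lam : ℝ} (hlam : 0 < lam)
    {t : ℝ} (ht : ρ * |t| < 1) {z : ℝ} (hz : 0 ≤ z) :
    (∫ ξ in Set.Ioo 0 ρ, (((1 - t * ξ) ^ (-lam) : ℝ) : ℂ) * G ξ).re ≤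
        (∫ ξ in Set.Ioo 0 ρ, (((1 - t * ξ) ^ (-lam) * Real.exp (z * ξ) : ℝ) : ℂ) * G ξ).re ∧
      (∫ ξ in Set.Ioo 0 ρ, (((1 - t * ξ) ^ (-lam) * Real.exp (z * ξ) : ℝ) : ℂ) * G ξ).re ≤
        Real.exp (ρ * z) * (∫ ξ in Set.Ioo 0 ρ, (((1 - t * ξ) ^ (-lam) : ℝ) : ℂ) * G ξ).re := by
  have hi := (hasSum_genBinom_integral hG hlam ht z).1
  have hi0 : IntegrableOn (fun ξ => (((1 - t * ξ) ^ (-lam) : ℝ) : ℂ) * G ξ) (Set.Ioo 0 ρ) := by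
    simpa using (hasSum_genBinom_integral hG hlam ht 0).1
  have hre : ∀ {f : ℝ → ℂ}, IntegrableOn f (Set.Ioo 0 ρ) →
      (∫ ξ in Set.Ioo 0 ρ, f ξ).re = ∫ ξ in Set.Ioo 0 ρ, (f ξ).re := fun hf =>
    (integral_re hf).symm
  have hnn : ∀ ξ ∈ Set.Ioo 0 ρ, 0 ≤ (1 - t * ξ) ^ (-lam) * (G ξ).re := fun ξ hξ => by
    have h1 : t * ξ ≤ |t| * ρ := by
      calc t * ξ ≤ |t| * ξ := mul_le_mul_of_nonneg_right (le_abs_self t) hξ.1.le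
        _ ≤ |t| * ρ := mul_le_mul_of_nonneg_left hξ.2.le (abs_nonneg t)
    exact mul_nonneg (Real.rpow_nonneg (by linarith) _) (hpos ξ hξ)
  rw [hre hi, hre hi0, ← integral_const_mul]
  simp only [Complex.re_ofReal_mul]
  have hir : IntegrableOn (fun ξ => (1 - t * ξ) ^ (-lam) * Real.exp (z * ξ) * (G ξ).re)
      (Set.Ioo 0 ρ) := by simpa only [IntegrableOn, RCLike.re_eq_complex_re,
        Complex.re_ofReal_mul] using hi.re
  have hir0 : IntegrableOn (fun ξ => (1 - t * ξ) ^ (-lam) * (G ξ).re) (Set.Ioo 0 ρ) := by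
    simpa only [IntegrableOn, RCLike.re_eq_complex_re, Complex.re_ofReal_mul] using hi0.re
  constructor
  · refine setIntegral_mono_on hir0 hir measurableSet_Ioo fun ξ hξ => ?_
    rw [mul_right_comm]
    exact le_mul_of_one_le_right (hnn ξ hξ) (Real.one_le_exp (mul_nonneg hz hξ.1.le))
  · refine setIntegral_mono_on hir (hir0.const_mul _) measurableSet_Ioo fun ξ hξ => ?_
    rw [mul_right_comm, mul_comm]
    refine mul_le_mul_of_nonneg_right (Real.exp_le_exp.2 ?_) (hnn ξ hξ)
    rw [mul_comm]
    exact mul_le_mul_of_nonneg_right hξ.2.le hz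

end FoxWright

/-! ### The generating function and the inequality -/

theorem theorem1 {p q : ℕ} (a A : Fin p → ℝ) (b B : Fin q → ℝ)
    (hA : ∀ j, 0 < A j) (hB : ∀ j, 0 < B j)
    (hAB : ∑ j, A j = ∑ j, B j)
    (hμ : 0 < foxMu a b) (hγ : 0 < foxGamma a A)
    (c : ℝ) (hc : -foxGamma a A < c)
    (lam : ℝ) (hlam : 0 < lam) :
    -- the H-function is well defined on `(0, ρ)`
    (∀ ξ ∈ Set.Ioo (0 : ℝ) (foxRho A B),
      Tendsto (foxHTruncated a A b B c (ξ : ℂ)) atTop (𝓝 (foxH a A b B c (ξ : ℂ)))) ∧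
    -- the generating function
    (∀ t z : ℝ, foxRho A B * |t| < 1 →
      (∀ k : ℕ, Summable
        (foxWrightTerm (fun l => a l + k * A l) A (fun l => b l + k * B l) B z)) ∧
      IntervalIntegrable
        (fun ξ : ℝ => (Real.exp (-ξ * (-z)) : ℂ) * foxIntegrand a A b B c lam t ξ)
        volume 0 (foxRho A B) ∧
      HasSum (fun k : ℕ => (genTerm a A b B lam z t k : ℂ))
        (finiteLaplace (foxRho A B) (foxIntegrand a A b B c lam t) (-z))) ∧
    -- the two-sided inequality
    (1 ≤ foxGamma a A →
      (∀ ξ ∈ Set.Ioo (0 : ℝ) (foxRho A B), 0 ≤ (foxH a A b B c (ξ : ℂ)).re) →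
      ∀ t z : ℝ, foxRho A B * |t| < 1 → 0 < z →
        Summable (foxWrightTerm (Fin.cons lam a : Fin (p + 1) → ℝ) (Fin.cons 1 A) b B t) ∧
        Summable (genTerm a A b B lam z t) ∧
        1 / Real.Gamma lam *
            foxWright (Fin.cons lam a : Fin (p + 1) → ℝ) (Fin.cons 1 A) b B t
          ≤ ∑' k : ℕ, genTerm a A b B lam z t k ∧
        ∑' k : ℕ, genTerm a A b B lam z t k
          ≤ Real.exp (foxRho A B * z) / Real.Gamma lam *
            foxWright (Fin.cons lam a : Fin (p + 1) → ℝ) (Fin.cons 1 A) b B t) := by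
  have hρ : 0 < foxRho A B := foxRho_pos hA hB
  obtain ⟨hlim, hmoments⟩ := foxH_moments (a := a) (b := b) hA hB hAB hμ hγ hc
  set ρ := foxRho A B
  set G : ℝ → ℂ := fun ξ => (ξ : ℂ)⁻¹ * foxH a A b B c (ξ : ℂ) with hGdef
  have hG : IntegrableOn G (Set.Ioo 0 ρ) := by simpa using (hmoments 0).1
  have hmom : ∀ n : ℕ, ∫ ξ in Set.Ioo 0 ρ, (ξ : ℂ) ^ n * G ξ = foxKernel a A b B n :=
    fun n => (hmoments n).2
  have hint : ∀ t z : ℝ,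
      (fun ξ : ℝ => (Real.exp (-ξ * (-z)) : ℂ) * foxIntegrand a A b B c lam t ξ) =
      fun ξ => (((1 - t * ξ) ^ (-lam) * Real.exp (z * ξ) : ℝ) : ℂ) * G ξ := by
    intro t z
    ext ξ
    rw [foxIntegrand, hGdef, neg_mul_neg, mul_comm ξ z]
    push_cast
    ring
  refine ⟨hlim, fun t z ht => ⟨fun k => (hasSum_foxWrightTerm hG hmom z k).1, ?_, ?_⟩,
    fun _ hpos t z ht hz => ?_⟩
  · rw [hint, intervalIntegrable_iff_integrableOn_Ioo_of_le hρ.le]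
    exact (hasSum_genBinom_integral hG hlam ht z).1
  · rw [finiteLaplace, hint, intervalIntegral.integral_of_le hρ.le,
      integral_Ioc_eq_integral_Ioo]
    exact hasSum_genTerm hG hmom hlam ht z
  · have hgen := hasSum_genTerm hG hmom hlam ht z
    have hfox := hasSum_foxWrightTerm_cons_one hG hmom hlam ht
    have hΓ := Real.Gamma_pos_of_pos hlam
    have hGpos : ∀ ξ ∈ Set.Ioo 0 ρ, 0 ≤ (G ξ).re := fun ξ hξ => by
      rw [hGdef]
      simp only
      rw [← Complex.ofReal_inv, Complex.re_ofReal_mul]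
      exact mul_nonneg (inv_nonneg.2 hξ.1.le) (hpos ξ hξ)
    obtain ⟨hlow, hupp⟩ := re_integral_exp_bounds hG hGpos hlam ht hz.le
    have hgen' : ∑' k, genTerm a A b B lam z t k =
        (∫ ξ in Set.Ioo 0 ρ, (((1 - t * ξ) ^ (-lam) * Real.exp (z * ξ) : ℝ) : ℂ) * G ξ).re := by
      rw [← hgen.tsum_eq, ← Complex.ofReal_tsum, Complex.ofReal_re]
    have hfox' : foxWright (Fin.cons lam a : Fin (p + 1) → ℝ) (Fin.cons 1 A) b B t =
        Real.Gamma lam *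
          (∫ ξ in Set.Ioo 0 ρ, (((1 - t * ξ) ^ (-lam) : ℝ) : ℂ) * G ξ).re := by
      rw [← Complex.re_ofReal_mul, ← hfox.tsum_eq, ← Complex.ofReal_tsum, Complex.ofReal_re,
        foxWright]
    refine ⟨Complex.summable_ofReal.1 hfox.summable, Complex.summable_ofReal.1 hgen.summable, ?_, ?_⟩
    · rw [hgen', hfox', one_div, inv_mul_cancel_left₀ hΓ.ne']
      exact hlow
    · rw [hgen', hfox', div_mul_eq_mul_div, mul_left_comm, mul_div_cancel_left₀ _ hΓ.ne']
      exact hupp
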